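/- Setting. Let $N_L\ge 1$, let $\mathbf x=(\mathbf X_1,\dots,\mathbf X_{N_L})\in\mathbb R^d$ collect weight matrices $\mathbf X_\ell\in\mathbb R^{m_\ell\times n_\ell}$, $d=\sum_\ell m_\ell n_\ell$, and let $1\le k_\ell\le m_\ell n_\ell$. Put $\underline\delta=\min_\ell \frac{k_\ell}{m_\ell n_\ell}$. Assume that $f:\mathbb R^d\to\mathbb R$ is bounded below and differentiable with $\|\nabla f(\mathbf x)-\nabla f(\mathbf y)\|_2\le L\|\mathbf x-\mathbf y\|_2$ for all $\mathbf x,\mathbf y$, where $L>0$, and that the stochastic gradient oracle $(F,\mathcal D)$ satisfies, for every $\mathbf x$ and $\ell$, $\mathbb E_{\xi\sim\mathcal D}[\nabla_\ell F(\mathbf x;\xi)]=\nabla_\ell f(\mathbf x)$ and $\mathbb E_{\xi\sim\mathcal D}\|\nabla_\ell F(\mathbf x;\xi)-\nabla_\ell f(\mathbf x)\|_F^2\le\sigma_\ell^2$ with $\sigma_\ell>0$ (where $\nabla_\ell$ is the gradient with respect to $\mathbf X_\ell$, and $(\mathbf x,\xi)\mapsto\nabla F(\mathbf x;\xi)$ is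 measurable). Put $\sigma=\sqrt{\sum_\ell\sigma_\ell^2}$ and $\Delta=f(\mathbf x^{(0)})-\inf_{\mathbf x} f(\mathbf x)$. Algorithm (large-batch GaSare with MSGD; parameters $\beta_1,\eta\in\mathbb R$ and $\tau,\mathcal B\in\mathbb N_{\ge1}$). Start from a deterministic $\mathbf x^{(0)}$ and $\mathbf M_\ell^{(-1)}=0$. All samples $\xi$ below are i.i.d. from $\mathcal D$. For $t=0,1,2,\dots$ and every $\ell$: if $\tau\mid t$, set $\mathbf G_\ell^{(t)}=\frac1{\mathcal B}\sum_{b=1}^{\mathcal B}\nabla_\ell F(\mathbf x^{(t)};\xi^{(t,b)})$ and $\mathbf S_\ell^{(t)}=\mathrm{Top}_{k_\ell}(\mathbf G_\ell^{(t)})$, the $0/1$ mask with exactly $k_\ell$ ones, placed at entries of $\mathbf G_\ell^{(t)}$ with the $k_\ell$ largest absolute values (ties are broken by an arbitrary fixed measurable rule); otherwise, set $\mathbf G_\ell^{(t)}=\nabla_\ell F(\mathbf x^{(t)};\xi^{(t)})$ and $\mathbf S_\ell^{(t)}=\mathbf S_\ell^{(t-1)}$. Then, with $\odot$ the entrywise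 product, $$\mathbf M_\ell^{(t)}=(1-\beta_1)\,\mathbf S_\ell^{(t)}\odot\mathbf M_\ell^{(t-1)}+\beta_1\,\mathbf S_\ell^{(t)}\odot\mathbf G_\ell^{(t)},\qquad \mathbf X_\ell^{(t+1)}=\mathbf X_\ell^{(t)}-\eta\,\mathbf S_\ell^{(t)}\odot\mathbf M_\ell^{(t)}.$$ Theorem (convergence of large-batch GaSare). (1) If $0<\beta_1\le1$, $\tau\ge\frac{64}{3\beta_1\underline\delta}$, $\mathcal B\ge1$ and $0<\eta\le\min\Big\{\frac1{4L},\sqrt{\frac{3\underline\delta\beta_1^2}{80L^2}},\sqrt{\frac{\underline\delta}{40\tau^2L^2}},\sqrt{\frac{3\beta_1}{32\tau L^2}}\Big\}$, then for every $K\ge1$ $$\frac1{K\tau}\sum_{t=0}^{K\tau-1}\mathbb E\|\nabla f(\mathbf x^{(t)})\|_2^2\le\frac{16\Delta}{\underline\delta\,\eta K\tau}+\Big(\frac{160}{3\beta_1\underline\delta\tau\mathcal B}+\frac{352}{3\underline\delta^2\mathcal B}+\frac{32\beta_1}{3\underline\delta}\Big)\sigma^2 .$$ (2) Let $\Delta>0$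 and let $T$ be an integer with $T\ge2+\frac{128}{3\underline\delta}+\frac{(128\sigma)^2}{9\sqrt{\underline\delta}L\Delta}$. With $$\beta_1=\Big(1+\sqrt{\tfrac{\underline\delta^{3/2}\sigma^2T}{L\Delta}}\Big)^{-1},\quad \tau=\Big\lceil\tfrac{64}{3\underline\delta\beta_1}\Big\rceil,\quad \eta=\Big(4L+\sqrt{\tfrac{80L^2}{3\underline\delta\beta_1^2}}+\sqrt{\tfrac{40\tau^2L^2}{\underline\delta}}+\sqrt{\tfrac{32\tau L^2}{3\beta_1}}\Big)^{-1},\quad \mathcal B=\Big\lceil\tfrac1{\underline\delta\beta_1}\Big\rceil,$$ one has $$\frac1T\sum_{t=0}^{T-1}\mathbb E\|\nabla f(\mathbf x^{(t)})\|_2^2\le C\left(\frac{L\Delta}{\underline\delta^{5/2}T}+\sqrt{\frac{L\Delta\sigma^2}{\underline\delta^{7/2}T}}\right).$$ (3) Consequently, if $\Delta>0$, then for every $\varepsilon>0$ there is a number of iterations $T$, admissible in (2), such that with the parameters of (2) one has $\frac1T\sum_{t=0}^{T-1}\mathbb E\|\nabla f(\mathbf x^{(t)})\|_2^2\le\varepsilon$,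 while the total number of stochastic gradients $\nabla F(\mathbf x;\xi)$ computed in these $T$ iterations ($\mathcal B$ of them at each iteration $t$ with $\tau\mid t$ and one at each other iteration) is at most $$C\left(\frac{L\Delta\sigma^2}{\underline\delta^{7/2}\varepsilon^2}+\frac{L\Delta}{\underline\delta^{5/2}\varepsilon}+\frac{\sigma^2}{\underline\delta^{1/2}L\Delta}+\frac1{\underline\delta}\right).$$ Here $C>0$ is an absolute constant, and all the expectations above are finite. -/

import Mathlib

open MeasureTheory ProbabilityTheory
open scoped Matrix

universe u v

namespace GaSare

noncomputable section

/-- The parameter space `ℝ^d`, `d = ∑ ℓ, m ℓ * n ℓ`, with the Euclidean norm; the coordinate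
`⟨ℓ, i, j⟩` is the `(i, j)` entry of the `ℓ`-th weight matrix. -/
abbrev Params {N : ℕ} (m n : Fin N → ℕ) : Type :=
  EuclideanSpace ℝ (Σ ℓ : Fin N, Fin (m ℓ) × Fin (n ℓ))

/-- A family of matrices, the `ℓ`-th one of size `m ℓ × n ℓ`. -/
abbrev Blocks {N : ℕ} (m n : Fin N → ℕ) : Type :=
  (ℓ : Fin N) → Matrix (Fin (m ℓ)) (Fin (n ℓ)) ℝ

/-- The weight matrices collected in a parameter vector. -/
def blocks {N : ℕ} {m n : Fin N → ℕ} (x : Params m n) : Blocks m n :=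
  fun ℓ => Matrix.of fun i j => x ⟨ℓ, (i, j)⟩

/-- The parameter vector that collects given weight matrices (inverse of `blocks`). -/
def assemble {N : ℕ} {m n : Fin N → ℕ} (X : Blocks m n) : Params m n :=
  WithLp.toLp 2 fun p => X p.1 p.2.1 p.2.2

/-- Squared Frobenius norm. -/
def frobSq {a b : ℕ} (A : Matrix (Fin a) (Fin b) ℝ) : ℝ := ∑ i, ∑ j, A i j ^ 2

/-- `S ∈ {0,1}^{a × b}` has exactly `k` ones. -/
def IsSparseMask {a b : ℕ} (k : ℕ) (S : Matrix (Fin a) (Fin b) ℝ) : Prop :=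
  (∀ i j, S i j = 0 ∨ S i j = 1) ∧ frobSq S = k

/-- `S` is a mask with `k` ones, placed at entries of `G` with the `k` largest absolute values. -/
def IsTopKMask {a b : ℕ} (k : ℕ) (G S : Matrix (Fin a) (Fin b) ℝ) : Prop :=
  IsSparseMask k S ∧ ∀ i j i' j', S i j = 1 → S i' j' = 0 → |G i' j'| ≤ |G i j|

/-- `topk` is a Top-`k` rule: it assigns to every matrix a Top-`k` mask of it
(ties are broken in an arbitrary measurable way). -/
def IsTopKRule {a b : ℕ} (k : ℕ)
    (topk : Matrix (Fin a) (Fin b) ℝ → Matrix (Fin a) (Fin b) ℝ) : Prop :=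
  Measurable (fun (g : Fin a → Fin b → ℝ) i j => topk (Matrix.of g) i j) ∧
    ∀ G, IsTopKMask k G (topk G)

/-- `f` is differentiable and its gradient is `L`-Lipschitz. -/
def IsSmooth {N : ℕ} {m n : Fin N → ℕ} (L : ℝ) (f : Params m n → ℝ) : Prop :=
  Differentiable ℝ f ∧ ∀ x y, ‖gradient f x - gradient f y‖ ≤ L * ‖x - y‖

/-- The stochastic gradient `∇F(x; ξ)` with respect to `x`. -/
def stochGrad {N : ℕ} {m n : Fin N → ℕ} {Ξ : Type u} (F : Params m n → Ξ → ℝ)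
    (x : Params m n) (ξ : Ξ) : Params m n :=
  gradient (fun y => F y ξ) x

/-- The gradient oracle `(F, 𝒟)` is unbiased for `∇f` and its `ℓ`-th block has variance
at most `(σ ℓ)²`. -/
structure IsGradientOracle {N : ℕ} {m n : Fin N → ℕ} {Ξ : Type u} [MeasurableSpace Ξ]
    (f : Params m n → ℝ) (F : Params m n → Ξ → ℝ) (𝒟 : Measure Ξ) (σ : Fin N → ℝ) : Prop where
  differentiable : ∀ x, ∀ᵐ ξ ∂𝒟, DifferentiableAt ℝ (fun y => F y ξ) x
  measurable : Measurable fun p : Params m n × Ξ => stochGrad F p.1 p.2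
  integrable : ∀ x ℓ i j, Integrable (fun ξ => blocks (stochGrad F x ξ) ℓ i j) 𝒟
  unbiased : ∀ x ℓ i j,
    ∫ ξ, blocks (stochGrad F x ξ) ℓ i j ∂𝒟 = blocks (gradient f x) ℓ i j
  integrable_sq : ∀ x ℓ, Integrable
    (fun ξ => frobSq (blocks (stochGrad F x ξ) ℓ - blocks (gradient f x) ℓ)) 𝒟
  variance_le : ∀ x ℓ,
    ∫ ξ, frobSq (blocks (stochGrad F x ξ) ℓ - blocks (gradient f x) ℓ) ∂𝒟 ≤ σ ℓ ^ 2

/-- The samples `ξ t b` (`b`-th sample of iteration `t`) are i.i.d. with law `𝒟`. -/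
structure IsSampleStream {Ω : Type v} [MeasurableSpace Ω] {Ξ : Type u} [MeasurableSpace Ξ]
    (μ : Measure Ω) (𝒟 : Measure Ξ) (ξ : ℕ → ℕ → Ω → Ξ) : Prop where
  measurable : ∀ t b, Measurable (ξ t b)
  law : ∀ t b, μ.map (ξ t b) = 𝒟
  indep : iIndepFun (fun p : ℕ × ℕ => ξ p.1 p.2) μ

/-- State before iteration `t`: iterate `x^{(t)}`, masks `S^{(t-1)}`, momenta `M^{(t-1)}`. -/
structure State {N : ℕ} (m n : Fin N → ℕ) : Type where
  x : Params m n
  S : Blocks m n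
  M : Blocks m n

/-- The gradient estimate `G^{(t)}`: average over a batch of `B` samples if `τ ∣ t`,
a single-sample stochastic gradient otherwise. -/
def gradEst {N : ℕ} {m n : Fin N → ℕ} {Ξ : Type u} (F : Params m n → Ξ → ℝ) (τ B t : ℕ)
    (ξ : ℕ → Ξ) (x : Params m n) : Blocks m n :=
  fun ℓ =>
    if τ ∣ t then (1 / (B : ℝ)) • ∑ b ∈ Finset.range B, blocks (stochGrad F x (ξ b)) ℓ
    else blocks (stochGrad F x (ξ 0)) ℓ

/-- Iteration `t` of large-batch GaSare with MSGD. -/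
def step {N : ℕ} {m n : Fin N → ℕ} {Ξ : Type u} (F : Params m n → Ξ → ℝ)
    (topk : (ℓ : Fin N) → Matrix (Fin (m ℓ)) (Fin (n ℓ)) ℝ → Matrix (Fin (m ℓ)) (Fin (n ℓ)) ℝ)
    (β η : ℝ) (τ B t : ℕ) (ξ : ℕ → Ξ) (s : State m n) : State m n :=
  let G : Blocks m n := gradEst F τ B t ξ s.x
  let S : Blocks m n := fun ℓ => if τ ∣ t then topk ℓ (G ℓ) else s.S ℓ
  let R : Blocks m n := fun ℓ => S ℓ ⊙ G ℓ
  let M : Blocks m n := fun ℓ => (1 - β) • (S ℓ ⊙ s.M ℓ) + β • R ℓ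
  { x := assemble fun ℓ => blocks s.x ℓ - η • (S ℓ ⊙ M ℓ)
    S := S
    M := M }

/-- The run started at `x₀` with zero momentum, driven by the samples `ξ t b`; the initial mask
is irrelevant, since a new mask is computed at `t = 0`. -/
def run {N : ℕ} {m n : Fin N → ℕ} {Ξ : Type u} (F : Params m n → Ξ → ℝ)
    (topk : (ℓ : Fin N) → Matrix (Fin (m ℓ)) (Fin (n ℓ)) ℝ → Matrix (Fin (m ℓ)) (Fin (n ℓ)) ℝ)
    (β η : ℝ) (τ B : ℕ) (x₀ : Params m n) (ξ : ℕ → ℕ → Ξ) : ℕ → State m n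
  | 0 => { x := x₀, S := 0, M := 0 }
  | t + 1 => step F topk β η τ B t (ξ t) (run F topk β η τ B x₀ ξ t)

/-- The random iterate `x^{(t)}`. -/
def iterate {N : ℕ} {m n : Fin N → ℕ} {Ω : Type v} {Ξ : Type u} (F : Params m n → Ξ → ℝ)
    (topk : (ℓ : Fin N) → Matrix (Fin (m ℓ)) (Fin (n ℓ)) ℝ → Matrix (Fin (m ℓ)) (Fin (n ℓ)) ℝ)
    (β η : ℝ) (τ B : ℕ) (x₀ : Params m n) (ξ : ℕ → ℕ → Ω → Ξ) (t : ℕ) (ω : Ω) : Params m n :=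
  (run F topk β η τ B x₀ (fun s b => ξ s b ω) t).x

/-- The expectations `𝔼‖∇f(x^{(t)})‖²`, `t < T`, are finite and their average is at most `c`. -/
def AvgSqGradLE {N : ℕ} {m n : Fin N → ℕ} {Ω : Type v} [MeasurableSpace Ω] (μ : Measure Ω)
    (f : Params m n → ℝ) (x : ℕ → Ω → Params m n) (T : ℕ) (c : ℝ) : Prop :=
  (∀ t < T, Integrable (fun ω => ‖gradient f (x t ω)‖ ^ 2) μ) ∧
    (1 / (T : ℝ)) * ∑ t ∈ Finset.range T, ∫ ω, ‖gradient f (x t ω)‖ ^ 2 ∂μ ≤ c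

/-- `δ̲ = min_ℓ k ℓ / (m ℓ * n ℓ)`. -/
def minDensity {N : ℕ} (m n k : Fin N → ℕ) : ℝ := ⨅ ℓ, (k ℓ : ℝ) / ((m ℓ : ℝ) * (n ℓ : ℝ))

/-- `σ = √(∑ ℓ, (σ ℓ)²)`. -/
def totalSigma {N : ℕ} (σ : Fin N → ℝ) : ℝ := √(∑ ℓ, σ ℓ ^ 2)

/-- `Δ = f(x₀) - inf f`. -/
def gap {N : ℕ} {m n : Fin N → ℕ} (f : Params m n → ℝ) (x₀ : Params m n) : ℝ := f x₀ - ⨅ x, f x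

/-- Momentum parameter for `T` iterations. -/
def betaChoice (L Δ σ δ : ℝ) (T : ℕ) : ℝ := (1 + √(δ ^ (3 / 2 : ℝ) * σ ^ 2 * T / (L * Δ)))⁻¹

/-- Mask changing period. -/
def tauChoice (δ β : ℝ) : ℕ := ⌈64 / (3 * δ * β)⌉₊

/-- Learning rate. -/
def etaChoice (L δ β : ℝ) (τ : ℕ) : ℝ :=
  (4 * L + √(80 * L ^ 2 / (3 * δ * β ^ 2)) + √(40 * (τ : ℝ) ^ 2 * L ^ 2 / δ)
    + √(32 * (τ : ℝ) * L ^ 2 / (3 * β)))⁻¹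

/-- Large batch size. -/
def batchChoice (δ β : ℝ) : ℕ := ⌈1 / (δ * β)⌉₊

/-- Smallest admissible number of iterations. -/
def minIterations (L Δ σ δ : ℝ) : ℝ :=
  2 + 128 / (3 * δ) + (128 * σ) ^ 2 / (9 * √δ * L * Δ)

/-- The number of stochastic gradients `∇F(x; ξ)` computed in `T` iterations. -/
def gradientEvals (τ B T : ℕ) : ℕ := ∑ t ∈ Finset.range T, if τ ∣ t then B else 1

end

end GaSare

/-! On each sample path the algorithm is gradient descent along a momentum `M t` that lies in the
range of an orthogonal projection `P t`, fixed within each period of length `τ`. The squared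
distance of `M t` to `P t (∇f (x t))` contracts by the factor `1 - β / 2` at every step, up to the
drift of the gradient and the gradient errors. At a renewal of `P` the old momentum is orthogonally
decomposed, so that changing the mask costs only a multiple of the squared norm of the new gradient;
this cost is paid once per period and is therefore absorbed once `τ` is of order `1 / (β δ)`.

A Top-k mask keeps at least the fraction `δ` of the squared norm of the estimated gradient. Since
`∇f` is Lipschitz and `x` moves little within a period, the mask chosen at a renewal still captures
most of this fraction of the true gradient at the later steps, which converts the descent of `f`
along `P t (∇f (x t))` into a bound on the full gradient.

All these inequalities hold pathwise. Randomness enters only after summation: the samples of an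
iteration are independent of the past, so the cross terms have zero mean and the squared error at a
renewal is divided by the batch size.
-/

namespace GaSare

open Finset

section Inequalities

variable {E : Type*} [SeminormedAddCommGroup E]

lemma norm_add_sq_le_weighted (v w : E) {c : ℝ} (hc : 0 < c) :
    ‖v + w‖ ^ 2 ≤ (1 + c) * ‖v‖ ^ 2 + (1 + 1 / c) * ‖w‖ ^ 2 := by
  have triangle : ‖v + w‖ ^ 2 ≤ (‖v‖ + ‖w‖) ^ 2 := by gcongr; exact norm_add_le v w
  have young : c * ‖v‖ ^ 2 + 1 / c * ‖w‖ ^ 2 - 2 * (‖v‖ * ‖w‖) = (c * ‖v‖ - ‖w‖) ^ 2 / c := by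
    field_simp
    ring
  linarith [div_nonneg (sq_nonneg (c * ‖v‖ - ‖w‖)) hc.le]

lemma one_sub_mul_norm_add_sq_le (v w : E) {β : ℝ} (hβ0 : 0 < β) (hβ1 : β ≤ 1) :
    (1 - β) * ‖v + w‖ ^ 2 ≤ (1 - β / 2) * ‖v‖ ^ 2 + 2 / β * ‖w‖ ^ 2 := by
  have coeff_left : (1 - β) * (1 + β / 2) ≤ 1 - β / 2 := by nlinarith
  have coeff_right : (1 - β) * (1 + 1 / (β / 2)) ≤ 2 / β := by
    have : 2 / β - (1 - β) * (1 + 1 / (β / 2)) = 1 + β := by field_simp; ring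
    linarith
  calc (1 - β) * ‖v + w‖ ^ 2
      ≤ (1 - β) * ((1 + β / 2) * ‖v‖ ^ 2 + (1 + 1 / (β / 2)) * ‖w‖ ^ 2) :=
        mul_le_mul_of_nonneg_left (norm_add_sq_le_weighted v w (half_pos hβ0)) (sub_nonneg.2 hβ1)
    _ = (1 - β) * (1 + β / 2) * ‖v‖ ^ 2 + (1 - β) * (1 + 1 / (β / 2)) * ‖w‖ ^ 2 := by ring
    _ ≤ (1 - β / 2) * ‖v‖ ^ 2 + 2 / β * ‖w‖ ^ 2 := by gcongr

lemma norm_convexComb_sq_le [NormedSpace ℝ E] (v w : E) {β : ℝ} (hβ0 : 0 ≤ β) (hβ1 : β ≤ 1) :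
    ‖(1 - β) • v + β • w‖ ^ 2 ≤ (1 - β) * ‖v‖ ^ 2 + β * ‖w‖ ^ 2 :=
  ((convexOn_norm convex_univ).pow (fun _ _ => norm_nonneg _) 2).2 (Set.mem_univ v)
    (Set.mem_univ w) (sub_nonneg.2 hβ1) hβ0 (sub_add_cancel 1 β)

end Inequalities

section Projection

variable {E : Type*} [NormedAddCommGroup E] [InnerProductSpace ℝ E] {P P' : E →ₗ[ℝ] E}
  {m g g' z : E} {β : ℝ}

lemma norm_sq_eq_add_of_isSymmetricProjection (hP : P.IsSymmetricProjection) (v : E) :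
    ‖v‖ ^ 2 = ‖P v‖ ^ 2 + ‖v - P v‖ ^ 2 := by
  have orthogonal : inner ℝ (P v) (v - P v) = 0 := by
    rw [hP.isSymmetric, map_sub, ← Module.End.mul_apply, hP.isIdempotentElem.eq, sub_self,
      inner_zero_right]
  simpa [orthogonal] using norm_add_sq_real (P v) (v - P v)

lemma norm_sq_le_of_isSymmetricProjection (hP : P.IsSymmetricProjection) (v : E) :
    ‖P v‖ ^ 2 ≤ ‖v‖ ^ 2 := by
  rw [norm_sq_eq_add_of_isSymmetricProjection hP v]
  exact le_add_of_nonneg_right (sq_nonneg _)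

lemma norm_le_of_isSymmetricProjection (hP : P.IsSymmetricProjection) (v : E) : ‖P v‖ ≤ ‖v‖ :=
  (sq_le_sq₀ (norm_nonneg _) (norm_nonneg _)).1 (norm_sq_le_of_isSymmetricProjection hP v)

lemma tracking_error_le (hP : P.IsSymmetricProjection) (hβ0 : 0 < β) (hβ1 : β ≤ 1) :
    (1 - β) * ‖m - P g'‖ ^ 2 ≤ (1 - β / 2) * ‖m - P g‖ ^ 2 + 2 / β * ‖g' - g‖ ^ 2 := by
  rw [show m - P g' = (m - P g) + P (g - g') by rw [map_sub]; abel]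
  refine (one_sub_mul_norm_add_sq_le _ _ hβ0 hβ1).trans ?_
  rw [norm_sub_rev g' g]
  gcongr
  exact norm_le_of_isSymmetricProjection hP _

lemma momentum_error_le_of_same_projection (hP : P.IsSymmetricProjection) (hm : P m = m)
    (hβ0 : 0 < β) (hβ1 : β ≤ 1) :
    ‖P ((1 - β) • m + β • (g' + z)) - P g'‖ ^ 2
      ≤ (1 - β / 2) * ‖m - P g‖ ^ 2 + 2 / β * ‖g' - g‖ ^ 2
        + (β ^ 2 * ‖z‖ ^ 2 + 2 * β * (1 - β) * inner ℝ (m - P g') z) := by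
  have error_eq : P ((1 - β) • m + β • (g' + z)) - P g' = (1 - β) • (m - P g') + β • P z := by
    simp only [map_add, map_smul, hm]
    module
  have fixed : P (m - P g') = m - P g' := by
    rw [map_sub, hm, ← Module.End.mul_apply, hP.isIdempotentElem.eq]
  have inner_eq : inner ℝ (m - P g') (P z) = inner ℝ (m - P g') z := by
    rw [← hP.isSymmetric, fixed]
  have contraction : (1 - β) ^ 2 * ‖m - P g'‖ ^ 2 ≤ (1 - β) * ‖m - P g'‖ ^ 2 := by
    gcongr
    nlinarith
  have noise : β ^ 2 * ‖P z‖ ^ 2 ≤ β ^ 2 * ‖z‖ ^ 2 := by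
    gcongr
    exact norm_le_of_isSymmetricProjection hP z
  rw [error_eq, norm_add_sq_real, norm_smul, norm_smul, mul_pow, mul_pow, Real.norm_eq_abs, sq_abs,
    Real.norm_eq_abs, sq_abs, real_inner_smul_left, real_inner_smul_right, inner_eq]
  linarith [tracking_error_le (m := m) (g := g) (g' := g') hP hβ0 hβ1]

lemma momentum_error_le_of_new_projection (hP : P.IsSymmetricProjection)
    (hP' : P'.IsSymmetricProjection) (hm : P m = m) (hβ0 : 0 < β) (hβ1 : β ≤ 1) :
    ‖P' ((1 - β) • m + β • (g' + z)) - P' g'‖ ^ 2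
      ≤ (1 - β / 2) * ‖m - P g‖ ^ 2 + 2 / β * ‖g' - g‖ ^ 2 + (‖g'‖ ^ 2 + β * ‖z‖ ^ 2) := by
  have fixed : P (m - g') = m - P g' := by rw [map_sub, hm]
  have pythagoras : ‖m - g'‖ ^ 2 ≤ ‖m - P g'‖ ^ 2 + ‖g'‖ ^ 2 := by
    have := norm_sq_eq_add_of_isSymmetricProjection hP (m - g')
    rw [fixed, sub_sub_sub_cancel_left, norm_sub_rev (P g')] at this
    linarith [norm_sq_eq_add_of_isSymmetricProjection hP g', sq_nonneg ‖P g'‖]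
  calc ‖P' ((1 - β) • m + β • (g' + z)) - P' g'‖ ^ 2
      = ‖P' ((1 - β) • (m - g') + β • z)‖ ^ 2 := by
        rw [← map_sub]
        congr 3
        module
    _ ≤ ‖(1 - β) • (m - g') + β • z‖ ^ 2 := norm_sq_le_of_isSymmetricProjection hP' _
    _ ≤ (1 - β) * ‖m - g'‖ ^ 2 + β * ‖z‖ ^ 2 := norm_convexComb_sq_le _ _ hβ0.le hβ1
    _ ≤ (1 - β) * ‖m - P g'‖ ^ 2 + ‖g'‖ ^ 2 + β * ‖z‖ ^ 2 := by
        nlinarith [mul_le_mul_of_nonneg_left pythagoras (sub_nonneg.2 hβ1), sq_nonneg ‖g'‖]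
    _ ≤ (1 - β / 2) * ‖m - P g‖ ^ 2 + 2 / β * ‖g' - g‖ ^ 2 + (‖g'‖ ^ 2 + β * ‖z‖ ^ 2) := by
        linarith [tracking_error_le (m := m) (g := g) (g' := g') hP hβ0 hβ1]

lemma mul_norm_sq_le_of_retained (hP : P.IsSymmetricProjection) {δ : ℝ} (hδ0 : 0 ≤ δ) (hδ1 : δ ≤ 1)
    (h : δ * ‖g + z‖ ^ 2 ≤ ‖P (g + z)‖ ^ 2) :
    δ * ‖g‖ ^ 2 ≤ 3 / 2 * ‖P g‖ ^ 2 + 12 * ‖z‖ ^ 2 := by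
  have retained : √δ * ‖g + z‖ ≤ ‖P (g + z)‖ := by
    refine (sq_le_sq₀ (by positivity) (norm_nonneg _)).1 ?_
    rwa [mul_pow, Real.sq_sqrt hδ0]
  have sqrt_mul_norm_le : √δ * ‖g‖ ≤ ‖P g‖ + 2 * ‖z‖ := calc
    √δ * ‖g‖ ≤ √δ * (‖g + z‖ + ‖z‖) := by
      gcongr
      simpa using norm_sub_le (g + z) z
    _ ≤ ‖P (g + z)‖ + 1 * ‖z‖ := by
      rw [mul_add]
      gcongr
      exact Real.sqrt_le_one.2 hδ1
    _ ≤ ‖P g‖ + 2 * ‖z‖ := by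
      rw [map_add]
      linarith [norm_add_le (P g) (P z), norm_le_of_isSymmetricProjection hP z]
  have squared : (√δ * ‖g‖) ^ 2 ≤ (‖P g‖ + 2 * ‖z‖) ^ 2 := by gcongr
  rw [mul_pow, Real.sq_sqrt hδ0] at squared
  nlinarith [sq_nonneg (‖P g‖ - 4 * ‖z‖)]

end Projection

section Sums

lemma sum_range_mul_eq_sum_sum {M : Type*} [AddCommMonoid M] (f : ℕ → M) (K τ : ℕ) :
    ∑ t ∈ range (K * τ), f t = ∑ r ∈ range K, ∑ j ∈ range τ, f (r * τ + j) := by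
  induction K with
  | zero => simp
  | succ K ih => rw [Nat.succ_mul, sum_range_add, ih, sum_range_succ]

lemma sum_range_mul_ite_dvd {M : Type*} [AddCommMonoid M] (f : ℕ → M) {τ : ℕ} (hτ : 0 < τ)
    (K : ℕ) : ∑ t ∈ range (K * τ), (if τ ∣ t then f t else 0) = ∑ r ∈ range K, f (r * τ) := by
  rw [sum_range_mul_eq_sum_sum]
  refine sum_congr rfl fun r _ => ?_
  rw [sum_eq_single_of_mem 0 (mem_range.2 hτ), add_zero, if_pos (dvd_mul_left τ r)]
  intro j hj hj0
  rw [if_neg]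
  rw [Nat.dvd_add_right (dvd_mul_left τ r)]
  exact Nat.not_dvd_of_pos_of_lt (Nat.pos_of_ne_zero hj0) (mem_range.1 hj)

lemma sum_le_of_contraction {e d c : ℕ → ℝ} {β : ℝ} (hβ : β ≤ 1) (he : ∀ t, 0 ≤ e t)
    (hd : ∀ t, 0 ≤ d t) (h0 : e 0 ≤ c 0)
    (hs : ∀ t, e (t + 1) ≤ (1 - β / 2) * e t + d t + c (t + 1)) (T : ℕ) :
    β / 2 * ∑ t ∈ range T, e t ≤ ∑ t ∈ range T, d t + ∑ t ∈ range T, c t := by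
  have telescoped (T : ℕ) : β / 2 * ∑ t ∈ range T, e t + e T
      ≤ ∑ t ∈ range T, d t + ∑ t ∈ range (T + 1), c t := by
    induction T with
    | zero => simpa using h0
    | succ T ih =>
      rw [sum_range_succ e, sum_range_succ d, sum_range_succ c (T + 1)]
      linarith [hs T]
  cases T with
  | zero => simp
  | succ T =>
    rw [sum_range_succ e, sum_range_succ d]
    nlinarith [telescoped T, he T, hd T]

lemma norm_sub_sq_le_mul_sum {E : Type*} [SeminormedAddCommGroup E] (x : ℕ → E) (a : ℕ) {j τ : ℕ}
    (hj : j ≤ τ) :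
    ‖x (a + j) - x a‖ ^ 2 ≤ τ * ∑ i ∈ range τ, ‖x (a + i + 1) - x (a + i)‖ ^ 2 := calc
  ‖x (a + j) - x a‖ ^ 2 = ‖∑ i ∈ range j, (x (a + i + 1) - x (a + i))‖ ^ 2 :=
    congrArg (fun v => ‖v‖ ^ 2) (sum_range_sub (fun i => x (a + i)) j).symm
  _ ≤ (∑ i ∈ range j, ‖x (a + i + 1) - x (a + i)‖) ^ 2 := by gcongr; exact norm_sum_le _ _
  _ ≤ j * ∑ i ∈ range j, ‖x (a + i + 1) - x (a + i)‖ ^ 2 := by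
    simpa using sq_sum_le_card_mul_sum_sq (s := range j)
      (f := fun i => ‖x (a + i + 1) - x (a + i)‖)
  _ ≤ τ * ∑ i ∈ range τ, ‖x (a + i + 1) - x (a + i)‖ ^ 2 := by gcongr

end Sums

section Smooth

variable {E : Type*} [NormedAddCommGroup E] [InnerProductSpace ℝ E] [CompleteSpace E]
  {f : E → ℝ} {L : ℝ}

lemma le_quadratic_of_lipschitz_gradient (hf : Differentiable ℝ f)
    (hL : ∀ x y, ‖gradient f x - gradient f y‖ ≤ L * ‖x - y‖) (x d : E) :
    f (x + d) ≤ f x + inner ℝ (gradient f x) d + L / 2 * ‖d‖ ^ 2 := by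
  let φ : ℝ → ℝ := fun s => f (x + s • d) - s * inner ℝ (gradient f x) d - L / 2 * ‖d‖ ^ 2 * s ^ 2
  have hφ (s : ℝ) : HasDerivAt φ (inner ℝ (gradient f (x + s • d)) d
      - inner ℝ (gradient f x) d - L / 2 * ‖d‖ ^ 2 * (2 * s)) s := by
    have line : HasDerivAt (fun s : ℝ => x + s • d) d s := by
      simpa using ((hasDerivAt_id s).smul_const d).const_add x
    have along_line := (hf (x + s • d)).hasGradientAt.hasFDerivAt.comp_hasDerivAt s line
    exact ((along_line.sub ((hasDerivAt_id s).mul_const (inner ℝ (gradient f x) d))).sub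
      (((hasDerivAt_id s).pow 2).const_mul (L / 2 * ‖d‖ ^ 2))).congr_deriv (by simp)
  have antitone : AntitoneOn φ (Set.Icc 0 1) := by
    refine antitoneOn_of_deriv_nonpos (convex_Icc 0 1)
      (fun s _ => (hφ s).continuousAt.continuousWithinAt)
      (fun s _ => (hφ s).differentiableAt.differentiableWithinAt) fun s hs => ?_
    rw [interior_Icc] at hs
    rw [(hφ s).deriv, ← inner_sub_left]
    have cauchy_schwarz := real_inner_le_norm (gradient f (x + s • d) - gradient f x) d
    have lipschitz := hL (x + s • d) x
    rw [add_sub_cancel_left, norm_smul, Real.norm_of_nonneg hs.1.le] at lipschitz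
    nlinarith [mul_le_mul_of_nonneg_right lipschitz (norm_nonneg d)]
  have h := antitone (Set.left_mem_Icc.2 zero_le_one) (Set.right_mem_Icc.2 zero_le_one) zero_le_one
  simp only [φ, one_smul, zero_smul, add_zero] at h
  linarith

lemma descent_of_projected_step {P : E →ₗ[ℝ] E} {η : ℝ} {m : E} (hf : Differentiable ℝ f)
    (hL : ∀ x y, ‖gradient f x - gradient f y‖ ≤ L * ‖x - y‖) (hP : P.IsSymmetricProjection)
    (hm : P m = m) (hη : 0 < η) (x : E) :
    ‖P (gradient f x)‖ ^ 2 + (1 - L * η) * ‖m‖ ^ 2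
      ≤ ‖m - P (gradient f x)‖ ^ 2 + 2 / η * (f x - f (x - η • m)) := by
  have upper := le_quadratic_of_lipschitz_gradient hf hL x (-(η • m))
  have inner_eq : inner ℝ (gradient f x) (-(η • m)) = -(η * inner ℝ m (P (gradient f x))) := by
    rw [inner_neg_right, inner_smul_right, ← hP.isSymmetric, hm, real_inner_comm]
  rw [← sub_eq_add_neg, inner_eq, norm_neg, norm_smul, mul_pow, Real.norm_of_nonneg hη.le] at upper
  have decrease : 2 * inner ℝ m (P (gradient f x)) - L * η * ‖m‖ ^ 2
      ≤ 2 / η * (f x - f (x - η • m)) := by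
    rw [div_mul_eq_mul_div, le_div_iff₀ hη]
    linarith
  rw [norm_sub_sq_real]
  linarith

lemma norm_gradient_sub_sq_le (hL : ∀ x y, ‖gradient f x - gradient f y‖ ≤ L * ‖x - y‖) (a b : E) :
    ‖gradient f a - gradient f b‖ ^ 2 ≤ L ^ 2 * ‖a - b‖ ^ 2 := by
  rw [← mul_pow]
  gcongr
  exact hL a b

lemma norm_gradient_sq_le (hL : ∀ x y, ‖gradient f x - gradient f y‖ ≤ L * ‖x - y‖) (a b : E) :
    ‖gradient f a‖ ^ 2 ≤ 3 / 2 * ‖gradient f b‖ ^ 2 + 3 * (L ^ 2 * ‖a - b‖ ^ 2) := by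
  have := norm_add_sq_le_weighted (gradient f b) (gradient f a - gradient f b) one_half_pos
  rw [add_sub_cancel] at this
  linarith [norm_gradient_sub_sq_le hL a b]

lemma sum_norm_gradient_le (hL : ∀ x y, ‖gradient f x - gradient f y‖ ≤ L * ‖x - y‖) (x : ℕ → E)
    (K τ : ℕ) :
    ∑ t ∈ range (K * τ), ‖gradient f (x t)‖ ^ 2
      ≤ 3 / 2 * (τ * ∑ r ∈ range K, ‖gradient f (x (r * τ))‖ ^ 2)
        + 3 * (L ^ 2 * ∑ r ∈ range K, ∑ j ∈ range τ, ‖x (r * τ + j) - x (r * τ)‖ ^ 2) := by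
  rw [sum_range_mul_eq_sum_sum]
  refine (sum_le_sum fun r _ => sum_le_sum fun j _ =>
    norm_gradient_sq_le hL (x (r * τ + j)) (x (r * τ))).trans_eq ?_
  simp only [sum_add_distrib, ← mul_sum, sum_const, card_range, nsmul_eq_mul]

end Smooth

section Combination

lemma summed_tracking_le {δ β τ κ d e R c : ℝ} (hδ1 : δ ≤ 1) (hβ0 : 0 < β) (hτ0 : 0 < τ)
    (hτ : 64 / 3 ≤ δ * (β * τ)) (hκ : 40 * (κ * τ) ^ 2 ≤ δ) (hd : 0 ≤ d) (hR : 0 ≤ R)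
    (tracking : β / 2 * e ≤ 2 / β * κ ^ 2 * d + R + c) :
    e ≤ 1 / 10 * d + 3 / 32 * (δ * (τ * R)) + 2 / β * c := by
  have one_le_βτ : 1 ≤ β * τ := by nlinarith [mul_pos hβ0 hτ0]
  have κ_sq_le : 4 * κ ^ 2 / β ^ 2 ≤ 1 / 10 := by
    have : 40 * (κ * τ) ^ 2 ≤ (β * τ) ^ 2 := by nlinarith
    rw [div_le_div_iff₀ (by positivity) (by norm_num)]
    refine le_of_mul_le_mul_right ?_ (pow_pos hτ0 2)
    linarith
  have inv_β_le : 2 / β ≤ 3 / 32 * (δ * τ) := by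
    rw [div_le_iff₀ hβ0]
    linarith
  calc e = 2 / β * (β / 2 * e) := by field_simp
    _ ≤ 2 / β * (2 / β * κ ^ 2 * d + R + c) := by gcongr
    _ = 4 * κ ^ 2 / β ^ 2 * d + 2 / β * R + 2 / β * c := by field_simp; ring
    _ ≤ 1 / 10 * d + 3 / 32 * (δ * τ) * R + 2 / β * c := by gcongr
    _ = 1 / 10 * d + 3 / 32 * (δ * (τ * R)) + 2 / β * c := by ring

lemma combine_summed_inequalities {δ β τ κ p d e a q R n c Δ : ℝ} (hδ0 : 0 < δ) (hδ1 : δ ≤ 1)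
    (hβ0 : 0 < β) (hβ1 : β ≤ 1) (hτ0 : 0 < τ) (hτ : 64 / 3 ≤ δ * (β * τ))
    (hκ : 40 * (κ * τ) ^ 2 ≤ δ) (hd : 0 ≤ d) (hR : 0 ≤ R)
    (descent : p + (1 - κ) * d ≤ e + 2 * Δ)
    (tracking : β / 2 * e ≤ 2 / β * κ ^ 2 * d + R + c)
    (drift : q ≤ (κ * τ) ^ 2 * d)
    (gradient : a ≤ 3 / 2 * (τ * R) + 3 * q)
    (retained : δ * (τ * R) ≤ 9 / 4 * p + 9 / 2 * q + 12 * n) :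
    δ * a ≤ 9 * Δ + 24 * n + 9 / β * c := by
  have four_le_τ : 4 ≤ τ := by nlinarith [mul_pos hβ0 hτ0]
  have κ_le : κ ≤ 1 / 4 := by
    have : κ * τ ≤ 1 := by nlinarith
    nlinarith
  have kept_d : 3 / 4 * d ≤ (1 - κ) * d := by gcongr; linarith
  have q_le : q ≤ 1 / 40 * (δ * d) := by
    refine drift.trans ?_
    rw [← mul_assoc]
    gcongr
    linarith
  have δd_le : δ * d ≤ d := mul_le_of_le_one_left hd hδ1
  have δq_le : δ * q ≤ 1 / 40 * (δ * d) := by nlinarith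
  have δa_le : δ * a ≤ 3 / 2 * (δ * (τ * R)) + 3 * (δ * q) := by nlinarith
  have τR_nonneg : 0 ≤ δ * (τ * R) := by positivity
  have noise_eq : 9 / β * c = 9 / 2 * (2 / β * c) := by ring
  linarith [summed_tracking_le hδ1 hβ0 hτ0 hτ hκ hd hR tracking]

end Combination

section ProjectedMomentum

variable {E : Type*} [NormedAddCommGroup E] [InnerProductSpace ℝ E] [CompleteSpace E]

/-- Deterministic model of a run: gradient descent on `f` with momentum `M`, driven by gradients
with errors `z`, where the orthogonal projection `P t` is renewed every `τ` steps and then retains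
a `δ`-fraction of the inexact gradient. -/
structure IsProjectedMomentum (f : E → ℝ) (β η δ : ℝ) (τ : ℕ) (x M z : ℕ → E)
    (P : ℕ → E →ₗ[ℝ] E) : Prop where
  projection : ∀ t, (P t).IsSymmetricProjection
  projection_succ : ∀ t, ¬ τ ∣ t + 1 → P (t + 1) = P t
  retained : ∀ t, τ ∣ t →
    δ * ‖gradient f (x t) + z t‖ ^ 2 ≤ ‖P t (gradient f (x t) + z t)‖ ^ 2
  momentum_zero : M 0 = P 0 (β • (gradient f (x 0) + z 0))
  momentum_succ : ∀ t,
    M (t + 1) = P (t + 1) ((1 - β) • M t + β • (gradient f (x (t + 1)) + z (t + 1)))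
  iterate_succ : ∀ t, x (t + 1) = x t - η • M t

/-- The contribution of the gradient errors `z` to the recursion for the squared distance of the
momentum `M t` to the projected gradient `P t (∇f (x t))`. Its second branch is only used for
`t ≠ 0`. -/
noncomputable def momentumNoise (f : E → ℝ) (β : ℝ) (τ : ℕ) (x M z : ℕ → E)
    (P : ℕ → E →ₗ[ℝ] E) (t : ℕ) : ℝ :=
  if τ ∣ t then β * ‖z t‖ ^ 2
  else β ^ 2 * ‖z t‖ ^ 2 + 2 * β * (1 - β) * inner ℝ (M (t - 1) - P t (gradient f (x t))) (z t)

namespace IsProjectedMomentum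

variable {f : E → ℝ} {β η δ L : ℝ} {τ : ℕ} {x M z : ℕ → E} {P : ℕ → E →ₗ[ℝ] E}

lemma projection_momentum (h : IsProjectedMomentum f β η δ τ x M z P) (t : ℕ) :
    P t (M t) = M t := by
  have idem (v : E) : P t (P t v) = P t v := by
    rw [← Module.End.mul_apply, (h.projection t).isIdempotentElem.eq]
  cases t with
  | zero => rw [h.momentum_zero, idem]
  | succ t => rw [h.momentum_succ, idem]

lemma projection_period (h : IsProjectedMomentum f β η δ τ x M z P) (r : ℕ) {j : ℕ} (hj : j < τ) :
    P (r * τ + j) = P (r * τ) := by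
  induction j with
  | zero => rfl
  | succ j ih =>
    rw [← add_assoc, h.projection_succ, ih (Nat.lt_of_succ_lt hj)]
    rw [add_assoc, Nat.dvd_add_right (dvd_mul_left τ r)]
    exact Nat.not_dvd_of_pos_of_lt j.succ_pos hj

lemma norm_iterate_succ_sub_sq (h : IsProjectedMomentum f β η δ τ x M z P) (t : ℕ) :
    ‖x (t + 1) - x t‖ ^ 2 = η ^ 2 * ‖M t‖ ^ 2 := by
  rw [h.iterate_succ, sub_sub_cancel_left, norm_neg, norm_smul, mul_pow, Real.norm_eq_abs, sq_abs]

lemma momentum_error_zero (h : IsProjectedMomentum f β η δ τ x M z P) (hβ0 : 0 ≤ β) (hβ1 : β ≤ 1) :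
    ‖M 0 - P 0 (gradient f (x 0))‖ ^ 2 ≤ ‖gradient f (x 0)‖ ^ 2 + β * ‖z 0‖ ^ 2 := by
  set g := gradient f (x 0)
  calc ‖M 0 - P 0 g‖ ^ 2 = ‖P 0 ((1 - β) • (-g) + β • z 0)‖ ^ 2 := by
        rw [h.momentum_zero, ← map_sub]
        congr 3
        module
    _ ≤ ‖(1 - β) • (-g) + β • z 0‖ ^ 2 := norm_sq_le_of_isSymmetricProjection (h.projection 0) _
    _ ≤ (1 - β) * ‖-g‖ ^ 2 + β * ‖z 0‖ ^ 2 := norm_convexComb_sq_le _ _ hβ0 hβ1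
    _ ≤ ‖g‖ ^ 2 + β * ‖z 0‖ ^ 2 := by
        rw [norm_neg]
        linarith [mul_nonneg hβ0 (sq_nonneg ‖g‖)]

lemma momentum_error_succ (h : IsProjectedMomentum f β η δ τ x M z P)
    (hL : ∀ x y, ‖gradient f x - gradient f y‖ ≤ L * ‖x - y‖) (hβ0 : 0 < β) (hβ1 : β ≤ 1) (t : ℕ) :
    ‖M (t + 1) - P (t + 1) (gradient f (x (t + 1)))‖ ^ 2
      ≤ (1 - β / 2) * ‖M t - P t (gradient f (x t))‖ ^ 2 + 2 / β * ((L * η) ^ 2 * ‖M t‖ ^ 2)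
        + ((if τ ∣ t + 1 then ‖gradient f (x (t + 1))‖ ^ 2 else 0)
          + momentumNoise f β τ x M z P (t + 1)) := by
  have drift : ‖gradient f (x (t + 1)) - gradient f (x t)‖ ^ 2 ≤ (L * η) ^ 2 * ‖M t‖ ^ 2 := by
    refine (norm_gradient_sub_sq_le hL _ _).trans_eq ?_
    rw [h.norm_iterate_succ_sub_sq]
    ring
  have drift_term := mul_le_mul_of_nonneg_left drift (div_nonneg zero_le_two hβ0.le)
  rw [h.momentum_succ, momentumNoise]
  split_ifs with ht
  · linarith [momentum_error_le_of_new_projection (g := gradient f (x t))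
      (g' := gradient f (x (t + 1))) (z := z (t + 1)) (h.projection t) (h.projection (t + 1))
      (h.projection_momentum t) hβ0 hβ1]
  · rw [h.projection_succ t ht, Nat.add_sub_cancel]
    linarith [momentum_error_le_of_same_projection (g := gradient f (x t))
      (g' := gradient f (x (t + 1))) (z := z (t + 1)) (h.projection t)
      (h.projection_momentum t) hβ0 hβ1]

lemma sum_momentum_error_le (h : IsProjectedMomentum f β η δ τ x M z P)
    (hL : ∀ x y, ‖gradient f x - gradient f y‖ ≤ L * ‖x - y‖) (hβ0 : 0 < β) (hβ1 : β ≤ 1)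
    (hτ : 0 < τ) (K : ℕ) :
    β / 2 * ∑ t ∈ range (K * τ), ‖M t - P t (gradient f (x t))‖ ^ 2
      ≤ 2 / β * (L * η) ^ 2 * ∑ t ∈ range (K * τ), ‖M t‖ ^ 2
        + ∑ r ∈ range K, ‖gradient f (x (r * τ))‖ ^ 2
        + ∑ t ∈ range (K * τ), momentumNoise f β τ x M z P t := by
  refine (sum_le_of_contraction (d := fun t => 2 / β * ((L * η) ^ 2 * ‖M t‖ ^ 2))
    (c := fun t => (if τ ∣ t then ‖gradient f (x t)‖ ^ 2 else 0) + momentumNoise f β τ x M z P t)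
    hβ1 (fun t => sq_nonneg _) (fun t => by positivity) ?_
    (h.momentum_error_succ hL hβ0 hβ1) (K * τ)).trans_eq ?_
  · simpa [momentumNoise] using h.momentum_error_zero hβ0.le hβ1
  · rw [sum_add_distrib, sum_range_mul_ite_dvd (fun t => ‖gradient f (x t)‖ ^ 2) hτ, ← mul_sum,
      ← mul_sum]
    ring

lemma sum_norm_projected_gradient_le (h : IsProjectedMomentum f β η δ τ x M z P)
    (hf : Differentiable ℝ f) (hL : ∀ x y, ‖gradient f x - gradient f y‖ ≤ L * ‖x - y‖)
    (hη : 0 < η) (T : ℕ) :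
    ∑ t ∈ range T, ‖P t (gradient f (x t))‖ ^ 2 + (1 - L * η) * ∑ t ∈ range T, ‖M t‖ ^ 2
      ≤ ∑ t ∈ range T, ‖M t - P t (gradient f (x t))‖ ^ 2 + 2 / η * (f (x 0) - f (x T)) := by
  rw [← sum_range_sub' fun t => f (x t), mul_sum, mul_sum, ← sum_add_distrib, ← sum_add_distrib]
  refine sum_le_sum fun t _ => ?_
  rw [h.iterate_succ]
  exact descent_of_projected_step hf hL (h.projection t) (h.projection_momentum t) hη (x t)

lemma sum_drift_le (h : IsProjectedMomentum f β η δ τ x M z P) (K : ℕ) :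
    ∑ r ∈ range K, ∑ j ∈ range τ, ‖x (r * τ + j) - x (r * τ)‖ ^ 2
      ≤ τ ^ 2 * η ^ 2 * ∑ t ∈ range (K * τ), ‖M t‖ ^ 2 := by
  rw [sum_range_mul_eq_sum_sum, mul_sum]
  refine sum_le_sum fun r _ => ?_
  calc ∑ j ∈ range τ, ‖x (r * τ + j) - x (r * τ)‖ ^ 2
      ≤ ∑ _j ∈ range τ, τ * ∑ i ∈ range τ, ‖x (r * τ + i + 1) - x (r * τ + i)‖ ^ 2 :=
        sum_le_sum fun j hj => norm_sub_sq_le_mul_sum x (r * τ) (mem_range.1 hj).le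
    _ = τ ^ 2 * η ^ 2 * ∑ j ∈ range τ, ‖M (r * τ + j)‖ ^ 2 := by
        simp only [h.norm_iterate_succ_sub_sq, ← mul_sum, sum_const, card_range, nsmul_eq_mul]
        ring

lemma mul_norm_base_gradient_le (h : IsProjectedMomentum f β η δ τ x M z P)
    (hL : ∀ x y, ‖gradient f x - gradient f y‖ ≤ L * ‖x - y‖) (hδ0 : 0 ≤ δ) (hδ1 : δ ≤ 1)
    (r : ℕ) {j : ℕ} (hj : j < τ) :
    δ * ‖gradient f (x (r * τ))‖ ^ 2
      ≤ 9 / 4 * ‖P (r * τ + j) (gradient f (x (r * τ + j)))‖ ^ 2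
        + 9 / 2 * (L ^ 2 * ‖x (r * τ + j) - x (r * τ)‖ ^ 2) + 12 * ‖z (r * τ)‖ ^ 2 := by
  rw [h.projection_period r hj]
  set P₀ := P (r * τ)
  set g₀ := gradient f (x (r * τ))
  set g := gradient f (x (r * τ + j))
  have projected_drift : ‖P₀ g₀‖ ^ 2
      ≤ 3 / 2 * ‖P₀ g‖ ^ 2 + 3 * (L ^ 2 * ‖x (r * τ + j) - x (r * τ)‖ ^ 2) := by
    have weighted := norm_add_sq_le_weighted (P₀ g) (P₀ (g₀ - g)) one_half_pos
    have drift := norm_gradient_sub_sq_le hL (x (r * τ)) (x (r * τ + j))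
    rw [norm_sub_rev (x (r * τ))] at drift
    rw [← map_add, add_sub_cancel] at weighted
    linarith [norm_sq_le_of_isSymmetricProjection (h.projection (r * τ)) (g₀ - g)]
  linarith [mul_norm_sq_le_of_retained (h.projection (r * τ)) hδ0 hδ1
    (h.retained (r * τ) (dvd_mul_left τ r))]

lemma mul_sum_norm_base_gradient_le (h : IsProjectedMomentum f β η δ τ x M z P)
    (hL : ∀ x y, ‖gradient f x - gradient f y‖ ≤ L * ‖x - y‖) (hδ0 : 0 ≤ δ) (hδ1 : δ ≤ 1) (K : ℕ) :
    δ * (τ * ∑ r ∈ range K, ‖gradient f (x (r * τ))‖ ^ 2)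
      ≤ 9 / 4 * ∑ t ∈ range (K * τ), ‖P t (gradient f (x t))‖ ^ 2
        + 9 / 2 * (L ^ 2 * ∑ r ∈ range K, ∑ j ∈ range τ, ‖x (r * τ + j) - x (r * τ)‖ ^ 2)
        + 12 * (τ * ∑ r ∈ range K, ‖z (r * τ)‖ ^ 2) := by
  have := sum_le_sum fun r (_ : r ∈ range K) => sum_le_sum fun j (hj : j ∈ range τ) =>
    h.mul_norm_base_gradient_le hL hδ0 hδ1 r (mem_range.1 hj)
  rw [sum_range_mul_eq_sum_sum]
  simpa only [sum_add_distrib, ← mul_sum, sum_const, card_range, nsmul_eq_mul,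
    mul_left_comm _ (τ : ℝ)] using this

theorem mul_sum_norm_gradient_le (h : IsProjectedMomentum f β η δ τ x M z P)
    (hf : Differentiable ℝ f) (hL : ∀ x y, ‖gradient f x - gradient f y‖ ≤ L * ‖x - y‖)
    (hδ0 : 0 < δ) (hδ1 : δ ≤ 1) (hβ0 : 0 < β) (hβ1 : β ≤ 1) (hτ0 : 0 < τ)
    (hτ : 64 / 3 ≤ δ * (β * τ)) (hη0 : 0 < η) (hη : 40 * (L * η * τ) ^ 2 ≤ δ) (K : ℕ) :
    δ * ∑ t ∈ range (K * τ), ‖gradient f (x t)‖ ^ 2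
      ≤ 9 / η * (f (x 0) - f (x (K * τ))) + 24 * (τ * ∑ r ∈ range K, ‖z (r * τ)‖ ^ 2)
        + 9 / β * ∑ t ∈ range (K * τ), momentumNoise f β τ x M z P t := by
  have descent := h.sum_norm_projected_gradient_le hf hL hη0 (K * τ)
  have drift : L ^ 2 * ∑ r ∈ range K, ∑ j ∈ range τ, ‖x (r * τ + j) - x (r * τ)‖ ^ 2
      ≤ (L * η * τ) ^ 2 * ∑ t ∈ range (K * τ), ‖M t‖ ^ 2 :=
    (mul_le_mul_of_nonneg_left (h.sum_drift_le K) (sq_nonneg L)).trans_eq (by ring)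
  rw [div_mul_eq_mul_div, mul_div_assoc] at descent ⊢
  exact combine_summed_inequalities hδ0 hδ1 hβ0 hβ1 (Nat.cast_pos.2 hτ0) hτ hη
    (sum_nonneg fun _ _ => sq_nonneg _) (sum_nonneg fun _ _ => sq_nonneg _) descent
    (h.sum_momentum_error_le hL hβ0 hβ1 hτ0 K) drift (sum_norm_gradient_le hL x K τ)
    (h.mul_sum_norm_base_gradient_le hL hδ0.le hδ1 K)

end IsProjectedMomentum

end ProjectedMomentum

section SquareIntegrable

variable {Ω E : Type*} [MeasurableSpace Ω] {μ : Measure Ω} [NormedAddCommGroup E]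
  [InnerProductSpace ℝ E] {u w : Ω → E}

lemma integrable_inner_of_memLp (hu : MemLp u 2 μ) (hw : MemLp w 2 μ) :
    Integrable (fun ω => inner ℝ (u ω) (w ω)) μ := by
  refine Integrable.mono' ((hu.integrable_norm_pow two_ne_zero).add
    (hw.integrable_norm_pow two_ne_zero)) (hu.1.inner hw.1) (.of_forall fun ω => ?_)
  have young := two_mul_le_add_sq ‖u ω‖ ‖w ω‖
  have : 0 ≤ ‖u ω‖ * ‖w ω‖ := by positivity
  simp only [Pi.add_apply]
  linarith [norm_inner_le_norm (𝕜 := ℝ) (u ω) (w ω)]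

lemma integral_norm_add_sq_of_integral_inner_eq_zero (hu : MemLp u 2 μ) (hw : MemLp w 2 μ)
    (huw : ∫ ω, inner ℝ (u ω) (w ω) ∂μ = 0) :
    ∫ ω, ‖u ω + w ω‖ ^ 2 ∂μ = ∫ ω, ‖u ω‖ ^ 2 ∂μ + ∫ ω, ‖w ω‖ ^ 2 ∂μ := by
  have hu2 := hu.integrable_norm_pow two_ne_zero
  have hw2 := hw.integrable_norm_pow two_ne_zero
  have inner_integrable := (integrable_inner_of_memLp hu hw).const_mul 2
  simp only [norm_add_sq_real]
  rw [integral_add (hu2.fun_add inner_integrable) hw2, integral_add hu2 inner_integrable,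
    integral_const_mul, huw, mul_zero, add_zero]

end SquareIntegrable

section StochasticProjectedMomentum

variable {Ω E : Type*} [MeasurableSpace Ω] {μ : Measure Ω} [NormedAddCommGroup E]
  [InnerProductSpace ℝ E] [CompleteSpace E] {f : E → ℝ} {β η δ L V v : ℝ} {τ : ℕ} {x₀ : E}
  {X M Z : ℕ → Ω → E} {P : ℕ → Ω → E →ₗ[ℝ] E}

lemma continuous_gradient_of_lipschitz
    (hL : ∀ x y, ‖gradient f x - gradient f y‖ ≤ L * ‖x - y‖) : Continuous (gradient f) := by
  have : LipschitzWith L.toNNReal (gradient f) := .of_dist_le_mul fun x y => by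
    rw [dist_eq_norm, dist_eq_norm]
    exact (hL x y).trans (mul_le_mul_of_nonneg_right (Real.le_coe_toNNReal L) (norm_nonneg _))
  exact this.continuous

lemma memLp_gradient_comp [IsFiniteMeasure μ]
    (hL : ∀ x y, ‖gradient f x - gradient f y‖ ≤ L * ‖x - y‖)
    {Y : Ω → E} (hY : MemLp Y 2 μ) : MemLp (fun ω => gradient f (Y ω)) 2 μ := by
  refine ((hY.norm.const_mul L).add (memLp_const ‖gradient f 0‖)).of_le
    ((continuous_gradient_of_lipschitz hL).comp_aestronglyMeasurable hY.1) (.of_forall fun ω => ?_)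
  have lipschitz := hL (Y ω) 0
  rw [sub_zero] at lipschitz
  refine le_trans ?_ (le_abs_self _)
  simp only [Pi.add_apply]
  linarith [norm_le_norm_sub_add (gradient f (Y ω)) (gradient f 0)]

section

variable [IsFiniteMeasure μ]
  (hpath : ∀ ω, IsProjectedMomentum f β η δ τ (X · ω) (M · ω) (Z · ω) (P · ω))
  (hX0 : ∀ ω, X 0 ω = x₀) (hM : ∀ t, AEStronglyMeasurable (M t) μ) (hZ : ∀ t, MemLp (Z t) 2 μ)
  (hL : ∀ x y, ‖gradient f x - gradient f y‖ ≤ L * ‖x - y‖)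
include hpath hX0 hM hZ hL

lemma memLp_iterate_and_momentum (t : ℕ) : MemLp (X t) 2 μ ∧ MemLp (M t) 2 μ := by
  induction t with
  | zero =>
    have hX : MemLp (X 0) 2 μ := by
      rw [funext hX0]
      exact memLp_const x₀
    refine ⟨hX, (((memLp_gradient_comp hL hX).add (hZ 0)).const_smul β).of_le (hM 0)
      (.of_forall fun ω => ?_)⟩
    rw [(hpath ω).momentum_zero]
    exact norm_le_of_isSymmetricProjection ((hpath ω).projection 0) _
  | succ t ih =>
    have hX : MemLp (X (t + 1)) 2 μ := by
      rw [funext fun ω => (hpath ω).iterate_succ t]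
      exact ih.1.sub (ih.2.const_smul η)
    refine ⟨hX, ((ih.2.const_smul (1 - β)).add
      (((memLp_gradient_comp hL hX).add (hZ (t + 1))).const_smul β)).of_le
      (hM (t + 1)) (.of_forall fun ω => ?_)⟩
    rw [(hpath ω).momentum_succ]
    exact norm_le_of_isSymmetricProjection ((hpath ω).projection (t + 1)) _

lemma memLp_momentum_sub_projected_gradient {t : ℕ}
    (hP : AEStronglyMeasurable (fun ω => P (t + 1) ω (gradient f (X (t + 1) ω))) μ) :
    MemLp (fun ω => M t ω - P (t + 1) ω (gradient f (X (t + 1) ω))) 2 μ := by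
  have hX := (memLp_iterate_and_momentum hpath hX0 hM hZ hL (t + 1)).1
  exact (memLp_iterate_and_momentum hpath hX0 hM hZ hL t).2.sub
    ((memLp_gradient_comp hL hX).of_le hP (.of_forall fun ω =>
      norm_le_of_isSymmetricProjection ((hpath ω).projection (t + 1)) _))

end

/-- A random run of `IsProjectedMomentum` from `x₀`: the gradient errors `Z t` have second moment
at most `V` when the projection is renewed, and otherwise at most `v`, in which case they are
also uncorrelated with the momentum error carried over from the previous step. -/
structure IsStochasticProjectedMomentum (μ : Measure Ω) (f : E → ℝ) (β η δ V v : ℝ) (τ : ℕ)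
    (x₀ : E) (X M Z : ℕ → Ω → E) (P : ℕ → Ω → E →ₗ[ℝ] E) : Prop where
  path : ∀ ω, IsProjectedMomentum f β η δ τ (X · ω) (M · ω) (Z · ω) (P · ω)
  iterate_zero : ∀ ω, X 0 ω = x₀
  momentum_measurable : ∀ t, AEStronglyMeasurable (M t) μ
  projected_gradient_measurable :
    ∀ t, AEStronglyMeasurable (fun ω => P t ω (gradient f (X t ω))) μ
  error_memLp : ∀ t, MemLp (Z t) 2 μ
  error_sq_le : ∀ t, ∫ ω, ‖Z t ω‖ ^ 2 ∂μ ≤ if τ ∣ t then V else v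
  error_uncorrelated : ∀ t, ¬ τ ∣ t + 1 →
    ∫ ω, inner ℝ (M t ω - P (t + 1) ω (gradient f (X (t + 1) ω))) (Z (t + 1) ω) ∂μ = 0

namespace IsStochasticProjectedMomentum

lemma integrable_error_sq (h : IsStochasticProjectedMomentum μ f β η δ V v τ x₀ X M Z P) (t : ℕ) :
    Integrable (fun ω => ‖Z t ω‖ ^ 2) μ :=
  (h.error_memLp t).integrable_norm_pow two_ne_zero

variable [IsProbabilityMeasure μ]

lemma memLp_iterate (h : IsStochasticProjectedMomentum μ f β η δ V v τ x₀ X M Z P)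
    (hL : ∀ x y, ‖gradient f x - gradient f y‖ ≤ L * ‖x - y‖) (t : ℕ) : MemLp (X t) 2 μ :=
  (memLp_iterate_and_momentum h.path h.iterate_zero h.momentum_measurable h.error_memLp hL t).1

lemma integrable_norm_gradient_sq
    (h : IsStochasticProjectedMomentum μ f β η δ V v τ x₀ X M Z P)
    (hL : ∀ x y, ‖gradient f x - gradient f y‖ ≤ L * ‖x - y‖) (t : ℕ) :
    Integrable (fun ω => ‖gradient f (X t ω)‖ ^ 2) μ :=
  (memLp_gradient_comp hL (h.memLp_iterate hL t)).integrable_norm_pow two_ne_zero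

lemma integrable_inner_error (h : IsStochasticProjectedMomentum μ f β η δ V v τ x₀ X M Z P)
    (hL : ∀ x y, ‖gradient f x - gradient f y‖ ≤ L * ‖x - y‖) (t : ℕ) :
    Integrable (fun ω =>
      inner ℝ (M t ω - P (t + 1) ω (gradient f (X (t + 1) ω))) (Z (t + 1) ω)) μ := by
  exact integrable_inner_of_memLp (memLp_momentum_sub_projected_gradient h.path h.iterate_zero
    h.momentum_measurable h.error_memLp hL (h.projected_gradient_measurable (t + 1)))
    (h.error_memLp (t + 1))

lemma integrable_momentumNoise (h : IsStochasticProjectedMomentum μ f β η δ V v τ x₀ X M Z P)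
    (hL : ∀ x y, ‖gradient f x - gradient f y‖ ≤ L * ‖x - y‖) (t : ℕ) :
    Integrable (fun ω => momentumNoise f β τ (X · ω) (M · ω) (Z · ω) (P · ω) t) μ := by
  unfold momentumNoise
  split_ifs with ht
  · exact (h.integrable_error_sq t).const_mul β
  · obtain ⟨t, rfl⟩ := Nat.exists_eq_add_one_of_ne_zero fun h0 : t = 0 => ht (h0 ▸ dvd_zero τ)
    exact ((h.integrable_error_sq _).const_mul _).add ((h.integrable_inner_error hL t).const_mul _)

lemma integral_momentumNoise_le (h : IsStochasticProjectedMomentum μ f β η δ V v τ x₀ X M Z P)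
    (hL : ∀ x y, ‖gradient f x - gradient f y‖ ≤ L * ‖x - y‖) (hβ : 0 ≤ β) (t : ℕ) :
    ∫ ω, momentumNoise f β τ (X · ω) (M · ω) (Z · ω) (P · ω) t ∂μ
      ≤ if τ ∣ t then β * V else β ^ 2 * v := by
  have error_sq_le := h.error_sq_le t
  simp only [momentumNoise]
  split_ifs at error_sq_le ⊢ with ht
  · rw [integral_const_mul]
    exact mul_le_mul_of_nonneg_left error_sq_le hβ
  · obtain ⟨t, rfl⟩ := Nat.exists_eq_add_one_of_ne_zero fun h0 : t = 0 => ht (h0 ▸ dvd_zero τ)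
    simp only [Nat.add_sub_cancel]
    rw [integral_add ((h.integrable_error_sq _).const_mul _)
      ((h.integrable_inner_error hL t).const_mul _), integral_const_mul, integral_const_mul,
      h.error_uncorrelated t ht, mul_zero, add_zero]
    exact mul_le_mul_of_nonneg_left error_sq_le (sq_nonneg β)

lemma sum_integral_momentumNoise_le
    (h : IsStochasticProjectedMomentum μ f β η δ V v τ x₀ X M Z P)
    (hL : ∀ x y, ‖gradient f x - gradient f y‖ ≤ L * ‖x - y‖) (hβ : 0 ≤ β) (hv : 0 ≤ v)
    (hτ : 0 < τ) (K : ℕ) :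
    ∑ t ∈ range (K * τ), ∫ ω, momentumNoise f β τ (X · ω) (M · ω) (Z · ω) (P · ω) t ∂μ
      ≤ β * (K * V) + β ^ 2 * (K * τ * v) := by
  calc ∑ t ∈ range (K * τ), ∫ ω, momentumNoise f β τ (X · ω) (M · ω) (Z · ω) (P · ω) t ∂μ
      ≤ ∑ t ∈ range (K * τ), ((if τ ∣ t then β * V else 0) + β ^ 2 * v) := by
        refine sum_le_sum fun t _ => (h.integral_momentumNoise_le hL hβ t).trans ?_
        have : 0 ≤ β ^ 2 * v := by positivity
        split_ifs <;> linarith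
    _ = β * (K * V) + β ^ 2 * (K * τ * v) := by
        rw [sum_add_distrib, sum_range_mul_ite_dvd (fun _ => β * V) hτ]
        simp only [sum_const, card_range, nsmul_eq_mul, Nat.cast_mul]
        ring

theorem mul_sum_integral_norm_gradient_le
    (h : IsStochasticProjectedMomentum μ f β η δ V v τ x₀ X M Z P)
    (hf : Differentiable ℝ f) (hbdd : BddBelow (Set.range f))
    (hL : ∀ x y, ‖gradient f x - gradient f y‖ ≤ L * ‖x - y‖) (hv : 0 ≤ v)
    (hδ0 : 0 < δ) (hδ1 : δ ≤ 1) (hβ0 : 0 < β) (hβ1 : β ≤ 1) (hτ0 : 0 < τ)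
    (hτ : 64 / 3 ≤ δ * (β * τ)) (hη0 : 0 < η) (hη : 40 * (L * η * τ) ^ 2 ≤ δ) (K : ℕ) :
    δ * ∑ t ∈ range (K * τ), ∫ ω, ‖gradient f (X t ω)‖ ^ 2 ∂μ
      ≤ 9 / η * (f x₀ - ⨅ x, f x) + 24 * (τ * (K * V)) + (9 * (K * V) + 9 * β * (K * τ * v)) := by
  have error_integrable : Integrable (fun ω => 24 * (τ * ∑ r ∈ range K, ‖Z (r * τ) ω‖ ^ 2)) μ :=
    ((integrable_finsetSum _ fun r _ => h.integrable_error_sq (r * τ)).const_mul _).const_mul _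
  have noise_integrable : Integrable (fun ω => 9 / β * ∑ t ∈ range (K * τ),
      momentumNoise f β τ (X · ω) (M · ω) (Z · ω) (P · ω) t) μ :=
    (integrable_finsetSum _ fun t _ => h.integrable_momentumNoise hL t).const_mul _
  have gap_integrable := integrable_const (μ := μ) (9 / η * (f x₀ - ⨅ x, f x))
  have pathwise (ω : Ω) := (h.path ω).mul_sum_norm_gradient_le hf hL hδ0 hδ1 hβ0 hβ1 hτ0 hτ hη0 hη K
  have integrated := integral_mono
    ((integrable_finsetSum _ fun t _ => h.integrable_norm_gradient_sq hL t).const_mul δ)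
    ((gap_integrable.fun_add error_integrable).fun_add noise_integrable) fun ω =>
      (pathwise ω).trans (add_le_add_left (add_le_add_left (mul_le_mul_of_nonneg_left
        (sub_le_sub (congrArg f (h.iterate_zero ω)).le (ciInf_le hbdd _)) (by positivity)) _) _)
  have error_sum : ∑ r ∈ range K, ∫ ω, ‖Z (r * τ) ω‖ ^ 2 ∂μ ≤ K * V := by
    simpa using sum_le_sum fun r (_ : r ∈ range K) =>
      (h.error_sq_le (r * τ)).trans_eq (if_pos (dvd_mul_left τ r))
  have noise_sum := h.sum_integral_momentumNoise_le hL hβ0.le hv hτ0 K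
  rw [integral_const_mul, integral_finsetSum _ fun t _ => h.integrable_norm_gradient_sq hL t,
    integral_add (gap_integrable.fun_add error_integrable) noise_integrable,
    integral_add gap_integrable error_integrable, integral_const, probReal_univ, one_smul,
    integral_const_mul, integral_const_mul, integral_const_mul,
    integral_finsetSum _ fun r _ => h.integrable_error_sq _,
    integral_finsetSum _ fun t _ => h.integrable_momentumNoise hL t] at integrated
  have noise_term := mul_le_mul_of_nonneg_left noise_sum (div_nonneg (Nat.ofNat_nonneg 9) hβ0.le)
  have error_term := mul_le_mul_of_nonneg_left error_sum τ.cast_nonneg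
  have : 9 / β * (β * (K * V) + β ^ 2 * (K * τ * v)) = 9 * (K * V) + 9 * β * (K * τ * v) := by
    field_simp
  linarith

end IsStochasticProjectedMomentum

end StochasticProjectedMomentum

section Masks

lemma IsTopKMask.mul_frobSq_le {a b k : ℕ} {G S : Matrix (Fin a) (Fin b) ℝ}
    (h : IsTopKMask k G S) : k * frobSq G ≤ (a * b : ℝ) * frobSq (S ⊙ G) := by
  have comonotone : Monovary (fun p : Fin a × Fin b => S p.1 p.2 ^ 2)
      (fun p => G p.1 p.2 ^ 2) := by
    rintro ⟨i, j⟩ ⟨i', j'⟩ hG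
    contrapose! hG
    rcases h.1.1 i j with hS | hS <;> rcases h.1.1 i' j' with hS' | hS' <;>
      simp only [hS, hS'] at hG <;> norm_num at hG
    exact sq_le_sq.2 (h.2 i j i' j' hS hS')
  have chebyshev := comonotone.sum_mul_sum_le_card_mul_sum
  rw [← h.1.2]
  simpa [frobSq, Fintype.sum_prod_type, mul_pow] using chebyshev

variable {N : ℕ} {m n k : Fin N → ℕ}

lemma minDensity_pos (hN : 0 < N) (hk : ∀ ℓ, 1 ≤ k ℓ ∧ k ℓ ≤ m ℓ * n ℓ) :
    0 < minDensity m n k := by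
  have : Nonempty (Fin N) := ⟨⟨0, hN⟩⟩
  obtain ⟨ℓ, hℓ⟩ := exists_eq_ciInf_of_finite
    (f := fun ℓ : Fin N => (k ℓ : ℝ) / ((m ℓ : ℝ) * (n ℓ : ℝ)))
  rw [minDensity, ← hℓ]
  have entries_pos : 0 < m ℓ * n ℓ := (hk ℓ).1.trans (hk ℓ).2
  exact div_pos (mod_cast (hk ℓ).1) (mod_cast entries_pos)

lemma minDensity_le_one (hN : 0 < N) (hk : ∀ ℓ, k ℓ ≤ m ℓ * n ℓ) :
    minDensity m n k ≤ 1 :=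
  (ciInf_le (Set.finite_range _).bddBelow ⟨0, hN⟩).trans
    (div_le_one_of_le₀ (mod_cast hk ⟨0, hN⟩) (by positivity))

lemma sum_frobSq_blocks (v : Params m n) : ∑ ℓ, frobSq (blocks v ℓ) = ‖v‖ ^ 2 := by
  rw [EuclideanSpace.real_norm_sq_eq, Fintype.sum_sigma]
  simp [frobSq, blocks, Fintype.sum_prod_type]

/-- The blockwise entrywise product `S ⊙ ·`, as a linear endomorphism of the parameter space. -/
noncomputable def maskMul (S : Blocks m n) : Params m n →ₗ[ℝ] Params m n :=
  Matrix.toEuclideanLin (Matrix.diagonal (assemble S))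

lemma maskMul_apply (S : Blocks m n) (v : Params m n) (p : Σ ℓ : Fin N, Fin (m ℓ) × Fin (n ℓ)) :
    maskMul S v p = S p.1 p.2.1 p.2.2 * v p := by
  simp [maskMul, assemble, Matrix.toLpLin_apply, Matrix.mulVec_diagonal]

lemma isSymmetricProjection_maskMul {S : Blocks m n} (hS : ∀ ℓ i j, S ℓ i j = 0 ∨ S ℓ i j = 1) :
    (maskMul S).IsSymmetricProjection where
  isIdempotentElem := by
    ext v p
    simp only [Module.End.mul_apply, maskMul_apply]
    rcases hS p.1 p.2.1 p.2.2 with h | h <;> simp [h]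
  isSymmetric := by
    rw [maskMul, Matrix.isSymmetric_toEuclideanLin_iff]
    exact Matrix.isHermitian_diagonal _

lemma minDensity_mul_norm_sq_le {S : Blocks m n} {v : Params m n}
    (hk : ∀ ℓ, 1 ≤ k ℓ ∧ k ℓ ≤ m ℓ * n ℓ) (hS : ∀ ℓ, IsTopKMask (k ℓ) (blocks v ℓ) (S ℓ)) :
    minDensity m n k * ‖v‖ ^ 2 ≤ ‖maskMul S v‖ ^ 2 := by
  have blocks_maskMul (ℓ : Fin N) : blocks (maskMul S v) ℓ = S ℓ ⊙ blocks v ℓ := by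
    ext i j
    exact maskMul_apply S v ⟨ℓ, i, j⟩
  simp only [← sum_frobSq_blocks, blocks_maskMul, mul_sum]
  refine sum_le_sum fun ℓ _ => ?_
  have entries_pos : (0 : ℝ) < m ℓ * n ℓ := mod_cast (hk ℓ).1.trans (hk ℓ).2
  have frobSq_nonneg : 0 ≤ frobSq (blocks v ℓ) :=
    sum_nonneg fun _ _ => sum_nonneg fun _ _ => sq_nonneg _
  calc minDensity m n k * frobSq (blocks v ℓ)
      ≤ k ℓ / (m ℓ * n ℓ) * frobSq (blocks v ℓ) :=
        mul_le_mul_of_nonneg_right (ciInf_le (Set.finite_range _).bddBelow ℓ) frobSq_nonneg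
    _ ≤ frobSq (S ℓ ⊙ blocks v ℓ) := by
        rw [div_mul_eq_mul_div, div_le_iff₀' entries_pos]
        exact (hS ℓ).mul_frobSq_le

end Masks

section Run

variable {N : ℕ} {m n k : Fin N → ℕ} {Ξ : Type u}

/-- The error `G - ∇f(x)` of the gradient estimate of iteration `t` at the iterate `x`. -/
noncomputable def estError (f : Params m n → ℝ) (F : Params m n → Ξ → ℝ) (τ B t : ℕ) (ξ : ℕ → Ξ)
    (x : Params m n) : Params m n :=
  assemble (gradEst F τ B t ξ x) - gradient f x

variable {f : Params m n → ℝ} {F : Params m n → Ξ → ℝ}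
  {topk : (ℓ : Fin N) → Matrix (Fin (m ℓ)) (Fin (n ℓ)) ℝ → Matrix (Fin (m ℓ)) (Fin (n ℓ)) ℝ}
  {β η : ℝ} {τ B : ℕ} {x₀ : Params m n} {ξ : ℕ → ℕ → Ξ}

lemma run_mask_zero_or_one (htop : ∀ ℓ, IsTopKRule (k ℓ) (topk ℓ)) (t : ℕ) (ℓ : Fin N)
    (i : Fin (m ℓ)) (j : Fin (n ℓ)) :
    (run F topk β η τ B x₀ ξ t).S ℓ i j = 0 ∨ (run F topk β η τ B x₀ ξ t).S ℓ i j = 1 := by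
  induction t with
  | zero => exact Or.inl rfl
  | succ t ih =>
    by_cases ht : τ ∣ t
    · simpa [run, step, ht] using ((htop ℓ).2 (gradEst F τ B t (ξ t) _ ℓ)).1.1 i j
    · simpa [run, step, ht] using ih

theorem isProjectedMomentum_run (f : Params m n → ℝ) (hk : ∀ ℓ, 1 ≤ k ℓ ∧ k ℓ ≤ m ℓ * n ℓ)
    (htop : ∀ ℓ, IsTopKRule (k ℓ) (topk ℓ)) :
    IsProjectedMomentum f β η (minDensity m n k) τ (fun t => (run F topk β η τ B x₀ ξ t).x)
      (fun t => assemble (run F topk β η τ B x₀ ξ (t + 1)).M)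
      (fun t => estError f F τ B t (ξ t) (run F topk β η τ B x₀ ξ t).x)
      (fun t => maskMul (run F topk β η τ B x₀ ξ (t + 1)).S) where
  projection t := isSymmetricProjection_maskMul (run_mask_zero_or_one htop (t + 1))
  projection_succ t ht := by
    rw [run]
    simp only [step, ht, if_false]
  retained t ht := by
    rw [estError, add_sub_cancel]
    refine minDensity_mul_norm_sq_le hk fun ℓ => ?_
    rw [run]
    simp only [step, ht, if_true]
    exact (htop ℓ).2 _
  momentum_zero := by
    ext p
    rw [maskMul_apply]
    simp [run, step, assemble, estError]
    ring
  momentum_succ t := by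
    ext p
    rw [maskMul_apply, run]
    simp [step, assemble, estError]
    ring
  iterate_succ t := by
    ext p
    have mask_idem := run_mask_zero_or_one (F := F) (β := β) (η := η) (τ := τ) (B := B)
      (x₀ := x₀) (ξ := ξ) htop (t + 1) p.1 p.2.1 p.2.2
    rw [run] at mask_idem ⊢
    rcases mask_idem with h | h <;> simp only [step] at h <;> simp [step, assemble, blocks, h]

end Run

section Independence

variable {Ω α γ : Type*} [MeasurableSpace Ω] [MeasurableSpace α] [MeasurableSpace γ]
  {μ : Measure Ω} [IsFiniteMeasure μ] {Y : Ω → α} {ζ : Ω → γ} {h : α → γ → ℝ}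

lemma integral_eq_integral_integral_of_indepFun (hYζ : IndepFun Y ζ μ) (hY : Measurable Y)
    (hζ : Measurable ζ) (hm : Measurable fun p : α × γ => h p.1 p.2)
    (hi : Integrable (fun ω => h (Y ω) (ζ ω)) μ) :
    ∫ ω, h (Y ω) (ζ ω) ∂μ = ∫ y, ∫ z, h y z ∂(μ.map ζ) ∂(μ.map Y) := by
  have pair_measurable : Measurable fun ω => (Y ω, ζ ω) := hY.prodMk hζ
  have pair_law := (indepFun_iff_map_prod_eq_prod_map_map hY.aemeasurable hζ.aemeasurable).1 hYζ
  have pair_integrable :=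
    (integrable_map_measure hm.aestronglyMeasurable pair_measurable.aemeasurable).2 hi
  rw [pair_law] at pair_integrable
  rw [← integral_prod _ pair_integrable, ← pair_law,
    integral_map pair_measurable.aemeasurable hm.aestronglyMeasurable]

lemma integrable_of_indepFun_of_integral_le (hYζ : IndepFun Y ζ μ) (hY : Measurable Y)
    (hζ : Measurable ζ) (hm : Measurable fun p : α × γ => h p.1 p.2) (h0 : ∀ y z, 0 ≤ h y z)
    (hi : ∀ y, Integrable (h y) (μ.map ζ)) {c : ℝ} (hc : ∀ y, ∫ z, h y z ∂(μ.map ζ) ≤ c) :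
    Integrable (fun ω => h (Y ω) (ζ ω)) μ := by
  have pair_measurable : Measurable fun ω => (Y ω, ζ ω) := hY.prodMk hζ
  refine (integrable_map_measure hm.aestronglyMeasurable pair_measurable.aemeasurable).1 ?_
  rw [(indepFun_iff_map_prod_eq_prod_map_map hY.aemeasurable hζ.aemeasurable).1 hYζ,
    integrable_prod_iff hm.aestronglyMeasurable]
  refine ⟨.of_forall hi, .of_bound
    hm.norm.stronglyMeasurable.integral_prod_right'.aestronglyMeasurable c (.of_forall fun y => ?_)⟩
  simp only [Real.norm_of_nonneg (h0 _ _)]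
  rw [Real.norm_of_nonneg (integral_nonneg (h0 y))]
  exact hc y

lemma integral_le_of_indepFun [IsProbabilityMeasure μ] (hYζ : IndepFun Y ζ μ) (hY : Measurable Y)
    (hζ : Measurable ζ) (hm : Measurable fun p : α × γ => h p.1 p.2) (h0 : ∀ y z, 0 ≤ h y z)
    (hi : ∀ y, Integrable (h y) (μ.map ζ)) {c : ℝ} (hc : ∀ y, ∫ z, h y z ∂(μ.map ζ) ≤ c) :
    ∫ ω, h (Y ω) (ζ ω) ∂μ ≤ c := by
  have : IsProbabilityMeasure (μ.map Y) := Measure.isProbabilityMeasure_map hY.aemeasurable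
  rw [integral_eq_integral_integral_of_indepFun hYζ hY hζ hm
    (integrable_of_indepFun_of_integral_le hYζ hY hζ hm h0 hi hc)]
  refine (integral_mono_of_nonneg (.of_forall fun y => integral_nonneg (h0 y))
    (integrable_const c) (.of_forall hc)).trans_eq ?_
  simp

end Independence

section Oracle

variable {N : ℕ} {m n : Fin N → ℕ} {Ξ : Type u} {f : Params m n → ℝ} {F : Params m n → Ξ → ℝ}
  {L : ℝ}

/-- The error `∇F(x; z) - ∇f(x)` of the stochastic gradient. -/
noncomputable def gradNoise (f : Params m n → ℝ) (F : Params m n → Ξ → ℝ) (x : Params m n)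
    (z : Ξ) : Params m n :=
  stochGrad F x z - gradient f x

lemma blocks_sub (v w : Params m n) (ℓ : Fin N) : blocks (v - w) ℓ = blocks v ℓ - blocks w ℓ := rfl

lemma totalSigma_sq (σ : Fin N → ℝ) : totalSigma σ ^ 2 = ∑ ℓ, σ ℓ ^ 2 :=
  Real.sq_sqrt (sum_nonneg fun _ _ => sq_nonneg _)

variable [MeasurableSpace Ξ] {𝒟 : Measure Ξ} {σ : Fin N → ℝ}

namespace IsGradientOracle

lemma measurable_gradNoise (hF : IsGradientOracle f F 𝒟 σ) (hf : Continuous (gradient f)) :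
    Measurable fun p : Params m n × Ξ => gradNoise f F p.1 p.2 :=
  hF.measurable.sub (hf.measurable.comp measurable_fst)

lemma integrable_norm_gradNoise_sq (hF : IsGradientOracle f F 𝒟 σ) (x : Params m n) :
    Integrable (fun z => ‖gradNoise f F x z‖ ^ 2) 𝒟 := by
  simp only [gradNoise, ← sum_frobSq_blocks, blocks_sub]
  exact integrable_finsetSum _ fun ℓ _ => hF.integrable_sq x ℓ

lemma integral_norm_gradNoise_sq_le (hF : IsGradientOracle f F 𝒟 σ) (x : Params m n) :
    ∫ z, ‖gradNoise f F x z‖ ^ 2 ∂𝒟 ≤ totalSigma σ ^ 2 := by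
  simp only [gradNoise, ← sum_frobSq_blocks, blocks_sub]
  rw [integral_finsetSum _ fun ℓ _ => hF.integrable_sq x ℓ, totalSigma_sq]
  exact sum_le_sum fun ℓ _ => hF.variance_le x ℓ

lemma integral_inner_gradNoise [IsProbabilityMeasure 𝒟] (hF : IsGradientOracle f F 𝒟 σ)
    (x w : Params m n) : ∫ z, inner ℝ w (gradNoise f F x z) ∂𝒟 = 0 := by
  have stochGrad_integrable : Integrable (stochGrad F x) 𝒟 :=
    .of_eval_piLp fun p => hF.integrable x p.1 p.2.1 p.2.2
  have noise_integrable : Integrable (gradNoise f F x) 𝒟 :=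
    stochGrad_integrable.sub (integrable_const _)
  have stochGrad_mean : ∫ z, stochGrad F x z ∂𝒟 = gradient f x := by
    ext p
    rw [eval_integral_piLp fun p => stochGrad_integrable.eval_piLp p]
    exact hF.unbiased x p.1 p.2.1 p.2.2
  rw [integral_inner noise_integrable]
  simp only [gradNoise]
  rw [integral_sub stochGrad_integrable (integrable_const _), stochGrad_mean, integral_const,
    probReal_univ, one_smul, sub_self, inner_zero_right]

end IsGradientOracle

end Oracle

section Samples

variable {Ω : Type v} [mΩ : MeasurableSpace Ω] {Ξ : Type u} [MeasurableSpace Ξ]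
  {μ : Measure Ω} {𝒟 : Measure Ξ} {ξ : ℕ → ℕ → Ω → Ξ}

/-- The σ-algebra generated by the samples `ξ t b` with `(t, b) ∈ A`. -/
abbrev sampleAlg (ξ : ℕ → ℕ → Ω → Ξ) (A : Set (ℕ × ℕ)) : MeasurableSpace Ω :=
  ⨆ p ∈ A, MeasurableSpace.comap (ξ p.1 p.2) inferInstance

omit mΩ in
lemma sampleAlg_mono {A A' : Set (ℕ × ℕ)} (h : A ⊆ A') : sampleAlg ξ A ≤ sampleAlg ξ A' :=
  biSup_mono h

omit mΩ in
lemma measurable_sampleAlg {A : Set (ℕ × ℕ)} {t b : ℕ} (h : (t, b) ∈ A) :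
    Measurable[sampleAlg ξ A] (ξ t b) :=
  (comap_measurable (ξ t b)).mono (le_iSup₂ (f := fun (p : ℕ × ℕ) (_ : p ∈ A) =>
    MeasurableSpace.comap (ξ p.1 p.2) inferInstance) (t, b) h) le_rfl

namespace IsSampleStream

lemma sampleAlg_le (h : IsSampleStream μ 𝒟 ξ) (A : Set (ℕ × ℕ)) : sampleAlg ξ A ≤ mΩ :=
  iSup₂_le fun p _ => (h.measurable p.1 p.2).comap_le

lemma indepFun (h : IsSampleStream μ 𝒟 ξ) {A : Set (ℕ × ℕ)} {t b : ℕ} (hp : (t, b) ∉ A)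
    {γ : Type*} [MeasurableSpace γ] {Y : Ω → γ} (hY : Measurable[sampleAlg ξ A] Y) :
    IndepFun Y (ξ t b) μ := by
  have indep : Indep (sampleAlg ξ A) (MeasurableSpace.comap (ξ t b) inferInstance) μ := by
    simpa [sampleAlg] using indep_iSup_of_disjoint (m := fun p : ℕ × ℕ =>
      MeasurableSpace.comap (ξ p.1 p.2) inferInstance)
      (fun p => (h.measurable p.1 p.2).comap_le) h.indep.iIndep (Set.disjoint_singleton_right.2 hp)
  exact (IndepFun_iff_Indep _ _ _).2 (indep_of_indep_of_le_left indep hY.comap_le)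

end IsSampleStream

end Samples

section FreshNoise

variable {N : ℕ} {m n : Fin N → ℕ} {Ω : Type v} [MeasurableSpace Ω] {Ξ : Type u}
  [MeasurableSpace Ξ] {μ : Measure Ω} [IsProbabilityMeasure μ] {𝒟 : Measure Ξ}
  {f : Params m n → ℝ} {F : Params m n → Ξ → ℝ} {σ : Fin N → ℝ} {ξ : ℕ → ℕ → Ω → Ξ}
  {A : Set (ℕ × ℕ)} {t b : ℕ} {X U : Ω → Params m n}

lemma memLp_gradNoise_sample (hf : Continuous (gradient f)) (hF : IsGradientOracle f F 𝒟 σ)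
    (hξ : IsSampleStream μ 𝒟 ξ) (hX : Measurable[sampleAlg ξ A] X) (hp : (t, b) ∉ A) :
    MemLp (fun ω => gradNoise f F (X ω) (ξ t b ω)) 2 μ := by
  have hX' : Measurable X := hX.mono (hξ.sampleAlg_le A) le_rfl
  have noise_measurable : Measurable fun ω => gradNoise f F (X ω) (ξ t b ω) := by
    have noise_comp := (hF.measurable_gradNoise hf).comp (hX'.prodMk (hξ.measurable t b))
    exact noise_comp
  rw [memLp_two_iff_integrable_sq_norm noise_measurable.aestronglyMeasurable]
  refine integrable_of_indepFun_of_integral_le (h := fun x z => ‖gradNoise f F x z‖ ^ 2)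
    (c := totalSigma σ ^ 2) (hξ.indepFun hp hX) hX' (hξ.measurable t b)
    ((hF.measurable_gradNoise hf).norm.pow_const 2) (fun _ _ => sq_nonneg _) ?_ ?_ <;>
    rw [hξ.law]
  exacts [hF.integrable_norm_gradNoise_sq, hF.integral_norm_gradNoise_sq_le]

lemma integral_norm_gradNoise_sample_sq_le (hf : Continuous (gradient f))
    (hF : IsGradientOracle f F 𝒟 σ) (hξ : IsSampleStream μ 𝒟 ξ)
    (hX : Measurable[sampleAlg ξ A] X) (hp : (t, b) ∉ A) :
    ∫ ω, ‖gradNoise f F (X ω) (ξ t b ω)‖ ^ 2 ∂μ ≤ totalSigma σ ^ 2 := by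
  refine integral_le_of_indepFun (h := fun x z => ‖gradNoise f F x z‖ ^ 2)
    (hξ.indepFun hp hX) (hX.mono (hξ.sampleAlg_le A) le_rfl) (hξ.measurable t b)
    ((hF.measurable_gradNoise hf).norm.pow_const 2) (fun _ _ => sq_nonneg _) ?_ ?_ <;>
    rw [hξ.law]
  exacts [hF.integrable_norm_gradNoise_sq, hF.integral_norm_gradNoise_sq_le]

lemma integral_inner_gradNoise_sample_eq_zero [IsProbabilityMeasure 𝒟]
    (hf : Continuous (gradient f)) (hF : IsGradientOracle f F 𝒟 σ) (hξ : IsSampleStream μ 𝒟 ξ)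
    (hX : Measurable[sampleAlg ξ A] X) (hU : Measurable[sampleAlg ξ A] U) (hU2 : MemLp U 2 μ)
    (hp : (t, b) ∉ A) : ∫ ω, inner ℝ (U ω) (gradNoise f F (X ω) (ξ t b ω)) ∂μ = 0 := by
  have hXU : Measurable[sampleAlg ξ A] fun ω => (X ω, U ω) := hX.prodMk hU
  have inner_measurable : Measurable fun p : (Params m n × Params m n) × Ξ =>
      inner ℝ p.1.2 (gradNoise f F p.1.1 p.2) :=
    Measurable.inner (by fun_prop) ((hF.measurable_gradNoise hf).comp
      (g := fun p : Params m n × Ξ => gradNoise f F p.1 p.2)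
      (f := fun p : (Params m n × Params m n) × Ξ => (p.1.1, p.2)) (by fun_prop))
  rw [integral_eq_integral_integral_of_indepFun
    (h := fun (y : Params m n × Params m n) z => inner ℝ y.2 (gradNoise f F y.1 z))
    (hξ.indepFun hp hXU) (hXU.mono (hξ.sampleAlg_le A) le_rfl) (hξ.measurable t b)
    inner_measurable (integrable_inner_of_memLp hU2 (memLp_gradNoise_sample hf hF hξ hX hp)),
    hξ.law]
  simp only [hF.integral_inner_gradNoise, integral_zero]

lemma memLp_sum_gradNoise (hf : Continuous (gradient f)) (hF : IsGradientOracle f F 𝒟 σ)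
    (hξ : IsSampleStream μ 𝒟 ξ) (hX : Measurable[sampleAlg ξ A] X) (hp : ∀ b, (t, b) ∉ A) (B : ℕ) :
    MemLp (fun ω => ∑ b ∈ range B, gradNoise f F (X ω) (ξ t b ω)) 2 μ :=
  memLp_finsetSum _ fun b _ => memLp_gradNoise_sample hf hF hξ hX (hp b)

lemma integral_norm_sum_gradNoise_sq_le [IsProbabilityMeasure 𝒟] (hf : Continuous (gradient f))
    (hF : IsGradientOracle f F 𝒟 σ) (hξ : IsSampleStream μ 𝒟 ξ)
    (hX : Measurable[sampleAlg ξ A] X) (hp : ∀ b, (t, b) ∉ A) (B : ℕ) :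
    ∫ ω, ‖∑ b ∈ range B, gradNoise f F (X ω) (ξ t b ω)‖ ^ 2 ∂μ ≤ B * totalSigma σ ^ 2 := by
  induction B with
  | zero => simp
  | succ B ih =>
    let past : Set (ℕ × ℕ) := A ∪ {p | p.1 = t ∧ p.2 < B}
    have fresh : (t, B) ∉ past := by simp [past, hp B]
    have hX' : Measurable[sampleAlg ξ past] X :=
      hX.mono (sampleAlg_mono Set.subset_union_left) le_rfl
    have partial_sum_measurable : Measurable[sampleAlg ξ past]
        fun ω => ∑ b ∈ range B, gradNoise f F (X ω) (ξ t b ω) :=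
      @Finset.measurable_fun_sum _ _ _ _ _ _ (sampleAlg ξ past) _ _ fun b hb =>
        (hF.measurable_gradNoise hf).comp
          (hX'.prodMk (measurable_sampleAlg (Or.inr ⟨rfl, mem_range.1 hb⟩)))
    have partial_sum_memLp := memLp_sum_gradNoise hf hF hξ hX hp B
    have orthogonal := integral_inner_gradNoise_sample_eq_zero hf hF hξ hX' partial_sum_measurable
      partial_sum_memLp fresh
    simp only [sum_range_succ]
    rw [integral_norm_add_sq_of_integral_inner_eq_zero partial_sum_memLp
      (memLp_gradNoise_sample hf hF hξ hX (hp B)) orthogonal]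
    have last_le := integral_norm_gradNoise_sample_sq_le hf hF hξ hX (hp B)
    push_cast
    linarith

end FreshNoise

section Measurability

variable {N : ℕ} {m n k : Fin N → ℕ} {Ω : Type v} [MeasurableSpace Ω]

lemma measurable_params_iff {x : Ω → Params m n} :
    Measurable x ↔ ∀ p, Measurable fun ω => x ω p :=
  ⟨fun h p => by fun_prop,
    fun h => (WithLp.measurable_toLp 2 _).comp (measurable_pi_iff.2 h)⟩

lemma measurable_maskMul {S : Ω → Blocks m n} {v : Ω → Params m n}
    (hS : Measurable fun ω => assemble (S ω)) (hv : Measurable v) :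
    Measurable fun ω => maskMul (S ω) (v ω) := by
  rw [measurable_params_iff] at hS hv ⊢
  intro p
  simp only [maskMul_apply]
  exact (hS p).mul (hv p)

variable {Ξ : Type u} [MeasurableSpace Ξ] {F : Params m n → Ξ → ℝ}
  {topk : (ℓ : Fin N) → Matrix (Fin (m ℓ)) (Fin (n ℓ)) ℝ → Matrix (Fin (m ℓ)) (Fin (n ℓ)) ℝ}
  {β η : ℝ} {τ B t : ℕ} {x₀ : Params m n}

lemma measurable_gradEst (hF : Measurable fun p : Params m n × Ξ => stochGrad F p.1 p.2)
    {x : Ω → Params m n} (hx : Measurable x) {ζ : ℕ → Ω → Ξ} (hζ : ∀ b, Measurable (ζ b)) :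
    Measurable fun ω => assemble (gradEst F τ B t (fun b => ζ b ω) (x ω)) := by
  have stochGrad_measurable (b : ℕ) : Measurable fun ω => stochGrad F (x ω) (ζ b ω) := by
    have stochGrad_comp := hF.comp (hx.prodMk (hζ b))
    exact stochGrad_comp
  simp only [measurable_params_iff] at stochGrad_measurable ⊢
  intro p
  by_cases ht : τ ∣ t
  · simp only [assemble, gradEst, ht, if_true, Matrix.smul_apply, Matrix.sum_apply, smul_eq_mul]
    exact (measurable_fun_sum _ fun b _ => stochGrad_measurable b p).const_mul _
  · simp only [assemble, gradEst, ht, if_false]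
    exact stochGrad_measurable 0 p

lemma measurable_topk (htop : ∀ ℓ, IsTopKRule (k ℓ) (topk ℓ)) {G : Ω → Blocks m n}
    (hG : Measurable fun ω => assemble (G ω)) :
    Measurable fun ω => assemble fun ℓ => topk ℓ (G ω ℓ) := by
  rw [measurable_params_iff] at hG ⊢
  rintro ⟨ℓ, i, j⟩
  have block_measurable : Measurable fun ω i j => G ω ℓ i j :=
    measurable_pi_iff.2 fun i => measurable_pi_iff.2 fun j => hG ⟨ℓ, i, j⟩
  have topk_measurable := (htop ℓ).1.comp block_measurable
  exact measurable_pi_iff.1 (measurable_pi_iff.1 topk_measurable i) j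

lemma measurable_step (hF : Measurable fun p : Params m n × Ξ => stochGrad F p.1 p.2)
    (htop : ∀ ℓ, IsTopKRule (k ℓ) (topk ℓ)) {ζ : ℕ → Ω → Ξ} (hζ : ∀ b, Measurable (ζ b))
    {s : Ω → State m n} (hx : Measurable fun ω => (s ω).x)
    (hS : Measurable fun ω => assemble (s ω).S) (hM : Measurable fun ω => assemble (s ω).M) :
    Measurable (fun ω => (step F topk β η τ B t (fun b => ζ b ω) (s ω)).x) ∧
      Measurable (fun ω => assemble (step F topk β η τ B t (fun b => ζ b ω) (s ω)).S) ∧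
      Measurable (fun ω => assemble (step F topk β η τ B t (fun b => ζ b ω) (s ω)).M) := by
  have estimate := measurable_gradEst (τ := τ) (B := B) (t := t) hF hx hζ
  have mask :
      Measurable fun ω => assemble (step F topk β η τ B t (fun b => ζ b ω) (s ω)).S := by
    by_cases ht : τ ∣ t
    · simp only [step, ht, if_true]
      exact measurable_topk htop estimate
    · simpa only [step, ht, if_false] using hS
  have momentum :
      Measurable fun ω => assemble (step F topk β η τ B t (fun b => ζ b ω) (s ω)).M := by
    rw [measurable_params_iff] at mask hM estimate ⊢
    exact fun p => (((mask p).mul (hM p)).const_mul (1 - β)).add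
      (((mask p).mul (estimate p)).const_mul β)
  refine ⟨?_, mask, momentum⟩
  rw [measurable_params_iff] at mask momentum hx ⊢
  exact fun p => (hx p).sub (((mask p).mul (momentum p)).const_mul η)

lemma measurable_run (hF : Measurable fun p : Params m n × Ξ => stochGrad F p.1 p.2)
    (htop : ∀ ℓ, IsTopKRule (k ℓ) (topk ℓ)) {ξ : ℕ → ℕ → Ω → Ξ}
    (hξ : ∀ s < t, ∀ b, Measurable (ξ s b)) :
    Measurable (fun ω => (run F topk β η τ B x₀ (fun s b => ξ s b ω) t).x) ∧
      Measurable (fun ω => assemble (run F topk β η τ B x₀ (fun s b => ξ s b ω) t).S) ∧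
      Measurable (fun ω => assemble (run F topk β η τ B x₀ (fun s b => ξ s b ω) t).M) := by
  induction t with
  | zero =>
    simp only [run]
    exact ⟨measurable_const, measurable_const, measurable_const⟩
  | succ t ih =>
    obtain ⟨hx, hS, hM⟩ := ih fun s hs => hξ s (hs.trans t.lt_succ_self)
    exact measurable_step hF htop (hξ t t.lt_succ_self) hx hS hM

end Measurability

section EstimateError

variable {N : ℕ} {m n : Fin N → ℕ} {Ξ : Type u} {f : Params m n → ℝ} {F : Params m n → Ξ → ℝ}
  {τ B t : ℕ}

lemma estError_of_dvd (hB : B ≠ 0) (ht : τ ∣ t) (ξ : ℕ → Ξ) (x : Params m n) :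
    estError f F τ B t ξ x = (1 / (B : ℝ)) • ∑ b ∈ range B, gradNoise f F x (ξ b) := by
  have estimate : assemble (gradEst F τ B t ξ x)
      = (1 / (B : ℝ)) • ∑ b ∈ range B, stochGrad F x (ξ b) := by
    ext p
    simp [gradEst, assemble, ht, blocks, Matrix.sum_apply]
  simp only [estError, estimate, gradNoise, sum_sub_distrib, sum_const, card_range, smul_sub,
    ← Nat.cast_smul_eq_nsmul ℝ, smul_smul]
  rw [one_div_mul_cancel (Nat.cast_ne_zero.2 hB), one_smul]

lemma estError_of_not_dvd (ht : ¬ τ ∣ t) (ξ : ℕ → Ξ) (x : Params m n) :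
    estError f F τ B t ξ x = gradNoise f F x (ξ 0) := by
  rw [estError, gradNoise]
  congr 1
  ext p
  simp only [assemble, gradEst, ht, if_false, blocks, Matrix.of_apply]

variable {Ω : Type v} [MeasurableSpace Ω] [MeasurableSpace Ξ] {μ : Measure Ω}
  [IsProbabilityMeasure μ] {𝒟 : Measure Ξ} {σ : Fin N → ℝ} {ξ : ℕ → ℕ → Ω → Ξ}
  {A : Set (ℕ × ℕ)} {X : Ω → Params m n}

lemma memLp_estError (hf : Continuous (gradient f)) (hF : IsGradientOracle f F 𝒟 σ)
    (hξ : IsSampleStream μ 𝒟 ξ) (hX : Measurable[sampleAlg ξ A] X) (hp : ∀ b, (t, b) ∉ A)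
    (hB : B ≠ 0) : MemLp (fun ω => estError f F τ B t (fun b => ξ t b ω) (X ω)) 2 μ := by
  by_cases ht : τ ∣ t
  · simp only [estError_of_dvd hB ht]
    exact (memLp_sum_gradNoise hf hF hξ hX hp B).const_smul (1 / (B : ℝ))
  · simp only [estError_of_not_dvd ht]
    exact memLp_gradNoise_sample hf hF hξ hX (hp 0)

lemma integral_norm_estError_sq_le [IsProbabilityMeasure 𝒟] (hf : Continuous (gradient f))
    (hF : IsGradientOracle f F 𝒟 σ) (hξ : IsSampleStream μ 𝒟 ξ)
    (hX : Measurable[sampleAlg ξ A] X) (hp : ∀ b, (t, b) ∉ A) (hB : B ≠ 0) :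
    ∫ ω, ‖estError f F τ B t (fun b => ξ t b ω) (X ω)‖ ^ 2 ∂μ
      ≤ if τ ∣ t then totalSigma σ ^ 2 / B else totalSigma σ ^ 2 := by
  split_ifs with ht
  · simp only [estError_of_dvd hB ht, norm_smul, mul_pow]
    rw [integral_const_mul, Real.norm_of_nonneg (by positivity)]
    calc (1 / (B : ℝ)) ^ 2 * ∫ ω, ‖∑ b ∈ range B, gradNoise f F (X ω) (ξ t b ω)‖ ^ 2 ∂μ
        ≤ (1 / (B : ℝ)) ^ 2 * (B * totalSigma σ ^ 2) := by
          gcongr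
          exact integral_norm_sum_gradNoise_sq_le hf hF hξ hX hp B
      _ = totalSigma σ ^ 2 / B := by
          have : (B : ℝ) ≠ 0 := Nat.cast_ne_zero.2 hB
          field_simp
  · simp only [estError_of_not_dvd ht]
    exact integral_norm_gradNoise_sample_sq_le hf hF hξ hX (hp 0)

end EstimateError

section RandomRun

variable {N : ℕ} {m n k : Fin N → ℕ} {Ω : Type v} [MeasurableSpace Ω] {Ξ : Type u}
  [MeasurableSpace Ξ] {μ : Measure Ω} [IsProbabilityMeasure μ] {𝒟 : Measure Ξ}
  {f : Params m n → ℝ} {F : Params m n → Ξ → ℝ} {L : ℝ} {σ : Fin N → ℝ} {ξ : ℕ → ℕ → Ω → Ξ}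
  {topk : (ℓ : Fin N) → Matrix (Fin (m ℓ)) (Fin (n ℓ)) ℝ → Matrix (Fin (m ℓ)) (Fin (n ℓ)) ℝ}
  {β η : ℝ} {τ B : ℕ} {x₀ : Params m n}

omit [MeasurableSpace Ω] in
lemma measurable_run_past (hF : IsGradientOracle f F 𝒟 σ)
    (htop : ∀ ℓ, IsTopKRule (k ℓ) (topk ℓ)) (t : ℕ) :
    Measurable[sampleAlg ξ {p | p.1 < t}]
        (fun ω => (run F topk β η τ B x₀ (fun s b => ξ s b ω) t).x) ∧
      Measurable[sampleAlg ξ {p | p.1 < t}]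
        (fun ω => assemble (run F topk β η τ B x₀ (fun s b => ξ s b ω) t).S) ∧
      Measurable[sampleAlg ξ {p | p.1 < t}]
        (fun ω => assemble (run F topk β η τ B x₀ (fun s b => ξ s b ω) t).M) :=
  @measurable_run _ _ _ _ _ (sampleAlg ξ {p | p.1 < t}) _ _ _ _ β η τ B t x₀ hF.measurable htop ξ
    fun _ hs _ => measurable_sampleAlg hs

omit [MeasurableSpace Ω] in
lemma measurable_projected_gradient_past (hf : Continuous (gradient f))
    (hF : IsGradientOracle f F 𝒟 σ) (htop : ∀ ℓ, IsTopKRule (k ℓ) (topk ℓ)) {s t : ℕ}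
    (hst : s ≤ t) :
    Measurable[sampleAlg ξ {p | p.1 < t}] fun ω =>
      maskMul (run F topk β η τ B x₀ (fun s b => ξ s b ω) t).S
        (gradient f (iterate F topk β η τ B x₀ ξ s ω)) := by
  have iterate_past : Measurable[sampleAlg ξ {p | p.1 < t}] (iterate F topk β η τ B x₀ ξ s) :=
    (measurable_run_past hF htop s).1.mono (sampleAlg_mono fun p hp => lt_of_lt_of_le hp hst) le_rfl
  exact @measurable_maskMul _ _ _ _ (sampleAlg ξ {p | p.1 < t}) _ _
    (measurable_run_past hF htop t).2.1
    (hf.measurable.comp (f := iterate F topk β η τ B x₀ ξ s) iterate_past)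

theorem isStochasticProjectedMomentum_run [IsProbabilityMeasure 𝒟]
    (hk : ∀ ℓ, 1 ≤ k ℓ ∧ k ℓ ≤ m ℓ * n ℓ) (hf : IsSmooth L f) (hF : IsGradientOracle f F 𝒟 σ)
    (hξ : IsSampleStream μ 𝒟 ξ) (htop : ∀ ℓ, IsTopKRule (k ℓ) (topk ℓ)) (hB : B ≠ 0) :
    IsStochasticProjectedMomentum μ f β η (minDensity m n k) (totalSigma σ ^ 2 / B)
      (totalSigma σ ^ 2) τ x₀ (iterate F topk β η τ B x₀ ξ)
      (fun t ω => assemble (run F topk β η τ B x₀ (fun s b => ξ s b ω) (t + 1)).M)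
      (fun t ω => estError f F τ B t (fun b => ξ t b ω) (iterate F topk β η τ B x₀ ξ t ω))
      (fun t ω => maskMul (run F topk β η τ B x₀ (fun s b => ξ s b ω) (t + 1)).S) := by
  have hgrad := continuous_gradient_of_lipschitz hf.2
  have path (ω : Ω) := isProjectedMomentum_run (F := F) (β := β) (η := η) (τ := τ) (B := B)
    (x₀ := x₀) (ξ := fun s b => ξ s b ω) f hk htop
  have iterate_past (t : ℕ) :
      Measurable[sampleAlg ξ {p | p.1 < t}] (iterate F topk β η τ B x₀ ξ t) :=
    (measurable_run_past hF htop t).1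
  have momentum_past (t : ℕ) : Measurable[sampleAlg ξ {p | p.1 < t + 1}] fun ω =>
      assemble (run F topk β η τ B x₀ (fun s b => ξ s b ω) (t + 1)).M :=
    (measurable_run_past hF htop (t + 1)).2.2
  have fresh (t b : ℕ) : (t, b) ∉ {p : ℕ × ℕ | p.1 < t} := lt_irrefl t
  have momentum_measurable (t : ℕ) := ((momentum_past t).mono (hξ.sampleAlg_le _)
    le_rfl).aestronglyMeasurable (μ := μ)
  have projected_gradient_measurable (t : ℕ) :=
    ((measurable_projected_gradient_past (ξ := ξ) (β := β) (η := η) (τ := τ) (B := B) (x₀ := x₀)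
      hgrad hF htop t.le_succ).mono (hξ.sampleAlg_le _) le_rfl).aestronglyMeasurable (μ := μ)
  have error_memLp (t : ℕ) := memLp_estError (τ := τ) hgrad hF hξ (iterate_past t) (fresh t) hB
  refine ⟨path, fun _ => rfl, momentum_measurable, projected_gradient_measurable, error_memLp,
    fun t => integral_norm_estError_sq_le hgrad hF hξ (iterate_past t) (fresh t) hB,
    fun t ht => ?_⟩
  have momentum_error_memLp := memLp_momentum_sub_projected_gradient path (fun _ => rfl)
    momentum_measurable error_memLp hf.2 (projected_gradient_measurable (t + 1))
  simp only [fun ω => (path ω).projection_succ t ht, estError_of_not_dvd ht]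
    at momentum_error_memLp ⊢
  exact integral_inner_gradNoise_sample_eq_zero hgrad hF hξ (iterate_past (t + 1))
    ((momentum_past t).sub (measurable_projected_gradient_past hgrad hF htop le_rfl))
    momentum_error_memLp (fresh (t + 1) 0)

end RandomRun

section Averages

variable {N : ℕ} {m n : Fin N → ℕ} {Ω : Type v} [MeasurableSpace Ω] {μ : Measure Ω}
  {f : Params m n → ℝ} {x : ℕ → Ω → Params m n} {T T' : ℕ} {c c' : ℝ}

lemma AvgSqGradLE.mono (h : AvgSqGradLE μ f x T c) (hc : c ≤ c') : AvgSqGradLE μ f x T c' :=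
  ⟨h.1, h.2.trans hc⟩

lemma AvgSqGradLE.of_longer (h : AvgSqGradLE μ f x T' c) (hT : 0 < T) (hTT' : T ≤ T') :
    AvgSqGradLE μ f x T (T' / T * c) := by
  refine ⟨fun t ht => h.1 t (ht.trans_le hTT'), ?_⟩
  have hT' : 0 < T' := hT.trans_le hTT'
  have sum_le := h.2
  rw [one_div, inv_mul_le_iff₀ (by positivity)] at sum_le ⊢
  calc ∑ t ∈ range T, ∫ ω, ‖gradient f (x t ω)‖ ^ 2 ∂μ
      ≤ ∑ t ∈ range T', ∫ ω, ‖gradient f (x t ω)‖ ^ 2 ∂μ :=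
        sum_le_sum_of_subset_of_nonneg (range_subset_range.2 hTT')
          fun _ _ _ => integral_nonneg fun _ => sq_nonneg _
    _ ≤ T' * c := sum_le
    _ = T * (T' / T * c) := by field_simp

end Averages

lemma exists_mul_between_of_le {τ T : ℕ} (hτ : 0 < τ) (hτT : τ ≤ T) :
    ∃ K, T ≤ K * τ ∧ K * τ ≤ 2 * T := by
  refine ⟨T / τ + 1, ?_, ?_⟩
  · rw [mul_comm]
    exact (Nat.lt_mul_div_succ T hτ).le
  · have := Nat.div_mul_le_self T τ
    rw [add_one_mul]
    omega

section Choices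

variable {L Δ s δ ε β : ℝ} {τ B T : ℕ}

lemma betaChoice_pos : 0 < betaChoice L Δ s δ T := by
  rw [betaChoice]
  positivity

lemma betaChoice_le_one : betaChoice L Δ s δ T ≤ 1 :=
  inv_le_one_of_one_le₀ (le_add_of_nonneg_right (Real.sqrt_nonneg _))

lemma le_tauChoice : 64 / (3 * β * δ) ≤ (tauChoice δ β : ℝ) := by
  rw [tauChoice, mul_right_comm 3 β δ]
  exact Nat.le_ceil _

lemma tauChoice_pos (hδ : 0 < δ) (hβ : 0 < β) : 0 < tauChoice δ β :=
  Nat.ceil_pos.2 (by positivity)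

lemma one_le_batchChoice (hδ : 0 < δ) (hβ : 0 < β) : 1 ≤ batchChoice δ β :=
  Nat.one_le_ceil_iff.2 (by positivity)

lemma batchChoice_le_tauChoice (hδ : 0 < δ) (hβ : 0 < β) : batchChoice δ β ≤ tauChoice δ β := by
  refine Nat.ceil_mono ?_
  rw [div_le_div_iff₀ (by positivity) (by positivity)]
  nlinarith [mul_pos hδ hβ]

lemma tauChoice_le_div (hδ0 : 0 < δ) (hδ1 : δ ≤ 1) (hβ0 : 0 < β) (hβ1 : β ≤ 1) :
    (tauChoice δ β : ℝ) ≤ 23 / (δ * β) := by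
  have one_le : 1 ≤ 1 / (δ * β) := (one_le_div (by positivity)).2 (mul_le_one₀ hδ1 hβ0.le hβ1)
  calc (tauChoice δ β : ℝ) ≤ 64 / (3 * δ * β) + 1 := (Nat.ceil_lt_add_one (by positivity)).le
    _ = 64 / 3 * (1 / (δ * β)) + 1 := by field_simp
    _ ≤ 23 * (1 / (δ * β)) := by linarith
    _ = 23 / (δ * β) := by ring

lemma minIterations_pos (hL : 0 < L) (hΔ : 0 < Δ) (hδ : 0 < δ) : 0 < minIterations L Δ s δ := by
  rw [minIterations]
  positivity

lemma minIterations_le (hL : 0 < L) (hΔ : 0 < Δ) (hδ0 : 0 < δ) (hδ1 : δ ≤ 1) :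
    minIterations L Δ s δ ≤ 45 * (1 / δ) + 1821 * (s ^ 2 / (δ ^ (1 / 2 : ℝ) * L * Δ)) := by
  have density_term : 2 + 128 / (3 * δ) ≤ 45 * (1 / δ) := by
    have := (one_le_div hδ0).2 hδ1
    rw [← div_div, div_eq_mul_one_div (128 / 3) δ]
    linarith
  have noise_term : (128 * s) ^ 2 / (9 * √δ * L * Δ)
      ≤ 1821 * (s ^ 2 / (δ ^ (1 / 2 : ℝ) * L * Δ)) := by
    rw [← Real.sqrt_eq_rpow]
    calc (128 * s) ^ 2 / (9 * √δ * L * Δ) = 16384 / 9 * (s ^ 2 / (√δ * L * Δ)) := by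
          field_simp
          ring
      _ ≤ 1821 * (s ^ 2 / (√δ * L * Δ)) := by gcongr; norm_num
  exact add_le_add density_term noise_term

lemma tauChoice_betaChoice_le (hL : 0 < L) (hΔ : 0 < Δ) (hδ : 0 < δ)
    (hT : minIterations L Δ s δ ≤ T) : tauChoice δ (betaChoice L Δ s δ T) ≤ T := by
  set u := √(δ ^ (3 / 2 : ℝ) * s ^ 2 * T / (L * Δ)) with hu
  have T_pos : (0 : ℝ) < T := (minIterations_pos hL hΔ hδ).trans_le hT
  rw [minIterations] at hT
  have noise_le : (128 * s) ^ 2 / (9 * √δ * L * Δ) ≤ T := by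
    have : 0 < 128 / (3 * δ) := by positivity
    linarith
  have density_le : 64 / (3 * δ) ≤ T / 2 - 1 := by
    have : 0 ≤ (128 * s) ^ 2 / (9 * √δ * L * Δ) := by positivity
    linarith [show 128 / (3 * δ) = 2 * (64 / (3 * δ)) by ring]
  have beta_term_le : 64 / (3 * δ) * u ≤ T / 2 := by
    refine abs_le_of_sq_le_sq' ?_ (by positivity) |>.2
    rw [mul_pow, Real.sq_sqrt (by positivity), Real.rpow_div_two_eq_sqrt _ hδ.le, Real.rpow_ofNat]
    calc (64 / (3 * δ)) ^ 2 * (√δ ^ 3 * s ^ 2 * T / (L * Δ))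
        = (128 * s) ^ 2 / (9 * √δ * L * Δ) * T / 4 := by
          nth_rewrite 1 [← Real.sq_sqrt hδ.le]
          field_simp
          ring
      _ ≤ (T : ℝ) * T / 4 := by gcongr
      _ = ((T : ℝ) / 2) ^ 2 := by ring
  rw [tauChoice, Nat.ceil_le, betaChoice, ← hu]
  calc 64 / (3 * δ * (1 + u)⁻¹) = 64 / (3 * δ) + 64 / (3 * δ) * u := by field_simp
    _ ≤ T := by linarith

lemma etaChoice_pos (hL : 0 < L) : 0 < etaChoice L δ β τ := by
  rw [etaChoice]
  positivity

lemma etaChoice_le_sqrt (hL : 0 < L) (hδ : 0 < δ) (hτ : 0 < τ) :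
    etaChoice L δ β τ ≤ √(δ / (40 * (τ : ℝ) ^ 2 * L ^ 2)) := by
  rw [← inv_div, Real.sqrt_inv, etaChoice]
  refine inv_anti₀ (Real.sqrt_pos.2 (by positivity)) ?_
  linarith [Real.sqrt_nonneg (80 * L ^ 2 / (3 * δ * β ^ 2)),
    Real.sqrt_nonneg (32 * (τ : ℝ) * L ^ 2 / (3 * β))]

lemma inv_etaChoice_le (hL : 0 < L) (hδ0 : 0 < δ) (hδ1 : δ ≤ 1) (hβ0 : 0 < β) (hβ1 : β ≤ 1) :
    (etaChoice L δ β (tauChoice δ β))⁻¹ ≤ 187 * (L / (δ ^ (3 / 2 : ℝ) * β)) := by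
  have hτ := tauChoice_le_div hδ0 hδ1 hβ0 hβ1
  rw [etaChoice, inv_inv, Real.rpow_div_two_eq_sqrt _ hδ0.le, Real.rpow_ofNat]
  set τ : ℝ := (tauChoice δ β : ℝ)
  have τ_nonneg : 0 ≤ τ := Nat.cast_nonneg _
  obtain ⟨w, hw0, hδw⟩ : ∃ w, 0 < w ∧ √δ = w := ⟨_, Real.sqrt_pos.2 hδ0, rfl⟩
  have hw1 : w ≤ 1 := hδw ▸ Real.sqrt_le_one.2 hδ1
  rw [hδw]
  obtain rfl : δ = w ^ 2 := by rw [← hδw, Real.sq_sqrt hδ0.le]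
  have weaken : L / (w * β) ≤ L / (w ^ 3 * β) := by
    have : w ^ 3 ≤ w := pow_le_of_le_one hw0.le hw1 three_ne_zero
    gcongr
  have smoothness_term : L ≤ L / (w ^ 3 * β) :=
    (le_div_iff₀ (by positivity)).2 <| mul_le_of_le_one_right hL.le <|
      mul_le_one₀ (pow_le_one₀ hw0.le hw1) hβ0.le hβ1
  have momentum_term : √(80 * L ^ 2 / (3 * w ^ 2 * β ^ 2)) ≤ 6 * (L / (w * β)) := by
    rw [Real.sqrt_le_left (by positivity)]
    calc 80 * L ^ 2 / (3 * w ^ 2 * β ^ 2) = 80 / 3 * (L / (w * β)) ^ 2 := by field_simp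
      _ ≤ 6 ^ 2 * (L / (w * β)) ^ 2 := by gcongr; norm_num
      _ = (6 * (L / (w * β))) ^ 2 := (mul_pow ..).symm
  have drift_term : √(40 * τ ^ 2 * L ^ 2 / w ^ 2) ≤ 161 * (L / (w ^ 3 * β)) := by
    rw [Real.sqrt_le_left (by positivity)]
    calc 40 * τ ^ 2 * L ^ 2 / w ^ 2
        ≤ 7 ^ 2 * (23 / (w ^ 2 * β)) ^ 2 * L ^ 2 / w ^ 2 := by gcongr; norm_num
      _ = (161 * (L / (w ^ 3 * β))) ^ 2 := by field_simp; norm_num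
  have period_term : √(32 * τ * L ^ 2 / (3 * β)) ≤ 16 * (L / (w * β)) := by
    rw [Real.sqrt_le_left (by positivity)]
    calc 32 * τ * L ^ 2 / (3 * β) ≤ 32 * (23 / (w ^ 2 * β)) * L ^ 2 / (3 * β) := by gcongr
      _ = 736 / 3 * (L / (w * β)) ^ 2 := by field_simp; norm_num
      _ ≤ 16 ^ 2 * (L / (w * β)) ^ 2 := by gcongr; norm_num
      _ = (16 * (L / (w * β))) ^ 2 := (mul_pow ..).symm
  linarith

lemma noise_coeff_le (hδ0 : 0 < δ) (hδ1 : δ ≤ 1) (hβ : 0 < β) (hτ : 0 < τ)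
    (hB : 1 / (δ * β) ≤ (B : ℝ)) :
    24 / (δ * B) + 9 / (δ * τ * B) + 9 * β / δ ≤ 42 * (β / δ) := by
  have hB0 : (0 : ℝ) < B := lt_of_lt_of_le (by positivity) hB
  have inv_batch_le : 1 / (δ * B) ≤ β / δ := by
    have : 1 ≤ B * (δ * β) := (div_le_iff₀ (by positivity)).1 hB
    rw [div_le_div_iff₀ (by positivity) hδ0]
    nlinarith
  have renewal_term : 9 / (δ * τ * B) ≤ 9 * (1 / (δ * B)) := by
    rw [mul_one_div]
    have : (1 : ℝ) ≤ τ := mod_cast hτ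
    gcongr
    exact le_mul_of_one_le_right hδ0.le this
  rw [div_eq_mul_one_div 24, mul_div_assoc]
  linarith

/-- The convergence rate of part (2), up to the absolute constant. -/
noncomputable def rateBound (L Δ s δ : ℝ) (T : ℕ) : ℝ :=
  L * Δ / (δ ^ (5 / 2 : ℝ) * T) + √(L * Δ * s ^ 2 / (δ ^ (7 / 2 : ℝ) * T))

lemma rateBound_nonneg (hL : 0 < L) (hΔ : 0 < Δ) (hδ : 0 < δ) : 0 ≤ rateBound L Δ s δ T := by
  rw [rateBound]
  positivity

lemma inv_betaChoice_mul_eq_rateBound (hL : 0 < L) (hΔ : 0 < Δ) (hδ : 0 < δ) (hT : 0 < T) :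
    (betaChoice L Δ s δ T)⁻¹ * (L * Δ / (δ ^ (5 / 2 : ℝ) * T)) = rateBound L Δ s δ T := by
  rw [betaChoice, inv_inv, rateBound, one_add_mul]
  congr 1
  rw [← Real.sqrt_sq (by positivity : 0 ≤ L * Δ / (δ ^ (5 / 2 : ℝ) * T)),
    ← Real.sqrt_mul (by positivity)]
  congr 1
  simp only [Real.rpow_div_two_eq_sqrt _ hδ.le, Real.rpow_ofNat]
  field_simp

lemma betaChoice_mul_le_rateBound (hL : 0 < L) (hΔ : 0 < Δ) (hδ : 0 < δ) (hT : 0 < T) :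
    betaChoice L Δ s δ T * (s ^ 2 / δ) ≤ rateBound L Δ s δ T := by
  set u := √(δ ^ (3 / 2 : ℝ) * s ^ 2 * T / (L * Δ)) with hu
  set v := √(L * Δ * s ^ 2 / (δ ^ (7 / 2 : ℝ) * T)) with hv
  have balance : s ^ 2 / δ = u * v := by
    rw [hu, hv, ← Real.sqrt_mul (by positivity), ← Real.sqrt_sq (by positivity : 0 ≤ s ^ 2 / δ)]
    congr 1
    simp only [Real.rpow_div_two_eq_sqrt _ hδ.le, Real.rpow_ofNat]
    nth_rewrite 1 [← Real.sq_sqrt hδ.le]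
    field_simp
  have beta_mul_le : betaChoice L Δ s δ T * u ≤ 1 := by
    rw [betaChoice, ← hu, inv_mul_le_one₀ (by positivity)]
    exact le_add_of_nonneg_left zero_le_one
  calc betaChoice L Δ s δ T * (s ^ 2 / δ) = betaChoice L Δ s δ T * u * v := by
        rw [balance, mul_assoc]
    _ ≤ v := mul_le_of_le_one_left (Real.sqrt_nonneg _) beta_mul_le
    _ ≤ rateBound L Δ s δ T := le_add_of_nonneg_left (by positivity)

lemma choices_bound_le_rateBound (hL : 0 < L) (hΔ : 0 < Δ) (hδ0 : 0 < δ) (hδ1 : δ ≤ 1)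
    (hT : 0 < T) (hβ : β = betaChoice L Δ s δ T) (hτ : τ = tauChoice δ β)
    (hB : B = batchChoice δ β) :
    9 * Δ / (δ * etaChoice L δ β τ * T)
      + 2 * ((24 / (δ * B) + 9 / (δ * τ * B) + 9 * β / δ) * s ^ 2)
      ≤ 1800 * rateBound L Δ s δ T := by
  have hβ0 : 0 < β := hβ ▸ betaChoice_pos
  have hβ1 : β ≤ 1 := hβ ▸ betaChoice_le_one
  have gap_term : 9 * Δ / (δ * etaChoice L δ β τ * T) ≤ 1683 * rateBound L Δ s δ T := by
    calc 9 * Δ / (δ * etaChoice L δ β τ * T) = 9 * Δ / (δ * T) * (etaChoice L δ β τ)⁻¹ := by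
          have := (etaChoice_pos (δ := δ) (β := β) (τ := τ) hL).ne'
          field_simp
      _ ≤ 9 * Δ / (δ * T) * (187 * (L / (δ ^ (3 / 2 : ℝ) * β))) := by
          gcongr
          exact hτ ▸ inv_etaChoice_le hL hδ0 hδ1 hβ0 hβ1
      _ = 1683 * (β⁻¹ * (L * Δ / (δ ^ (5 / 2 : ℝ) * T))) := by
          simp only [Real.rpow_div_two_eq_sqrt _ hδ0.le, Real.rpow_ofNat]
          nth_rewrite 1 [← Real.sq_sqrt hδ0.le]
          field_simp
          norm_num
      _ = 1683 * rateBound L Δ s δ T := by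
          rw [hβ, inv_betaChoice_mul_eq_rateBound hL hΔ hδ0 hT]
  have noise_term : (24 / (δ * B) + 9 / (δ * τ * B) + 9 * β / δ) * s ^ 2
      ≤ 42 * rateBound L Δ s δ T := by
    calc (24 / (δ * B) + 9 / (δ * τ * B) + 9 * β / δ) * s ^ 2 ≤ 42 * (β / δ) * s ^ 2 := by
          gcongr
          exact noise_coeff_le hδ0 hδ1 hβ0 (hτ ▸ tauChoice_pos hδ0 hβ0) (hB ▸ Nat.le_ceil _)
      _ = 42 * (β * (s ^ 2 / δ)) := by ring
      _ ≤ 42 * rateBound L Δ s δ T := by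
          gcongr
          exact hβ ▸ betaChoice_mul_le_rateBound hL hΔ hδ0 hT
  linarith [rateBound_nonneg (s := s) (T := T) hL hΔ hδ0]

lemma mul_rateBound_le {c : ℝ} (hc : 0 < c) (hδ : 0 < δ) (hε : 0 < ε) (hT : 0 < T)
    (hT₁ : 2 * c * (L * Δ / (δ ^ (5 / 2 : ℝ) * ε)) ≤ T)
    (hT₂ : 4 * c ^ 2 * (L * Δ * s ^ 2 / (δ ^ (7 / 2 : ℝ) * ε ^ 2)) ≤ T) :
    c * rateBound L Δ s δ T ≤ ε := by
  have gap_term : L * Δ / (δ ^ (5 / 2 : ℝ) * T) ≤ ε / (2 * c) := by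
    rw [mul_div_assoc', div_le_iff₀ (by positivity)] at hT₁
    rw [div_le_div_iff₀ (by positivity) (by positivity)]
    linarith
  have noise_term : √(L * Δ * s ^ 2 / (δ ^ (7 / 2 : ℝ) * T)) ≤ ε / (2 * c) := by
    rw [mul_div_assoc', div_le_iff₀ (by positivity)] at hT₂
    rw [Real.sqrt_le_left (by positivity), div_pow,
      div_le_div_iff₀ (by positivity) (by positivity)]
    linarith
  calc c * rateBound L Δ s δ T ≤ c * (ε / (2 * c) + ε / (2 * c)) := by
        rw [rateBound]
        gcongr
    _ = ε := by
        field_simp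
        norm_num

lemma exists_nat_mul_rateBound_le {c : ℝ} (hc : 0 < c) (hL : 0 < L) (hΔ : 0 < Δ) (hδ : 0 < δ)
    (hε : 0 < ε) :
    ∃ T : ℕ, minIterations L Δ s δ ≤ T ∧ c * rateBound L Δ s δ T ≤ ε ∧
      (T : ℝ) ≤ minIterations L Δ s δ + 2 * c * (L * Δ / (δ ^ (5 / 2 : ℝ) * ε))
        + 4 * c ^ 2 * (L * Δ * s ^ 2 / (δ ^ (7 / 2 : ℝ) * ε ^ 2)) + 1 := by
  have min_pos := minIterations_pos (s := s) hL hΔ hδ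
  have gap_nonneg : 0 ≤ 2 * c * (L * Δ / (δ ^ (5 / 2 : ℝ) * ε)) := by positivity
  have noise_nonneg : 0 ≤ 4 * c ^ 2 * (L * Δ * s ^ 2 / (δ ^ (7 / 2 : ℝ) * ε ^ 2)) := by positivity
  set z := minIterations L Δ s δ + 2 * c * (L * Δ / (δ ^ (5 / 2 : ℝ) * ε))
    + 4 * c ^ 2 * (L * Δ * s ^ 2 / (δ ^ (7 / 2 : ℝ) * ε ^ 2))
  have z_pos : 0 < z := by positivity
  have le_ceil := Nat.le_ceil z
  exact ⟨⌈z⌉₊, by linarith, mul_rateBound_le hc hδ hε (Nat.ceil_pos.2 z_pos) (by linarith)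
    (by linarith), (Nat.ceil_lt_add_one z_pos.le).le⟩

lemma gradientEvals_le (hτ : 0 < τ) (hτT : τ ≤ T) (hB : B ≤ τ) : gradientEvals τ B T ≤ 3 * T := by
  obtain ⟨K, hTK, hKT⟩ := exists_mul_between_of_le hτ hτT
  calc gradientEvals τ B T ≤ ∑ t ∈ range T, ((if τ ∣ t then B else 0) + 1) :=
        sum_le_sum fun t _ => by split_ifs <;> omega
    _ = ∑ t ∈ range T, (if τ ∣ t then B else 0) + T := by
        rw [sum_add_distrib, sum_const, card_range, smul_eq_mul, mul_one]
    _ ≤ ∑ t ∈ range (K * τ), (if τ ∣ t then B else 0) + T :=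
        Nat.add_le_add_right (sum_le_sum_of_subset (range_subset_range.2 hTK)) T
    _ = K * B + T := by
        rw [sum_range_mul_ite_dvd (fun _ => B) hτ, sum_const, card_range, smul_eq_mul]
    _ ≤ K * τ + T := Nat.add_le_add_right (Nat.mul_le_mul_left K hB) T
    _ ≤ 3 * T := by omega

end Choices

section Convergence

variable {N : ℕ} {m n k : Fin N → ℕ} {Ω : Type v} [MeasurableSpace Ω] {Ξ : Type u}
  [MeasurableSpace Ξ] {μ : Measure Ω} [IsProbabilityMeasure μ] {𝒟 : Measure Ξ}
  [IsProbabilityMeasure 𝒟] {f : Params m n → ℝ} {F : Params m n → Ξ → ℝ} {L : ℝ}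
  {σ : Fin N → ℝ} {ξ : ℕ → ℕ → Ω → Ξ}
  {topk : (ℓ : Fin N) → Matrix (Fin (m ℓ)) (Fin (n ℓ)) ℝ → Matrix (Fin (m ℓ)) (Fin (n ℓ)) ℝ}
  {x₀ : Params m n} {δ s Δ β η : ℝ} {τ B : ℕ}
  (hN : 0 < N) (hk : ∀ ℓ, 1 ≤ k ℓ ∧ k ℓ ≤ m ℓ * n ℓ) (hbdd : BddBelow (Set.range f))
  (hL : 0 < L) (hf : IsSmooth L f) (hF : IsGradientOracle f F 𝒟 σ) (hξ : IsSampleStream μ 𝒟 ξ)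
  (htop : ∀ ℓ, IsTopKRule (k ℓ) (topk ℓ)) (hδ : δ = minDensity m n k) (hs : s = totalSigma σ)
  (hΔ : Δ = gap f x₀)

include hN hk hbdd hL hf hF hξ htop hδ hs hΔ

theorem avgSqGradLE_iterate_mul {K : ℕ} (hβ0 : 0 < β) (hβ1 : β ≤ 1)
    (hτ : 64 / (3 * β * δ) ≤ (τ : ℝ)) (hη0 : 0 < η)
    (hη : η ≤ √(δ / (40 * (τ : ℝ) ^ 2 * L ^ 2))) (hB : 1 ≤ B) (hK : 1 ≤ K) :
    AvgSqGradLE μ f (iterate F topk β η τ B x₀ ξ) (K * τ)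
      (9 * Δ / (δ * η * (K * τ)) + (24 / (δ * B) + 9 / (δ * τ * B) + 9 * β / δ) * s ^ 2) := by
  have hδ0 : 0 < δ := hδ ▸ minDensity_pos hN hk
  have hδ1 : δ ≤ 1 := hδ ▸ minDensity_le_one hN fun ℓ => (hk ℓ).2
  have hτ0 : 0 < τ := Nat.cast_pos.1 (lt_of_lt_of_le (by positivity) hτ)
  have period_long : 64 / 3 ≤ δ * (β * τ) := by
    rw [div_le_iff₀ (by positivity)] at hτ
    linarith
  have step_small : 40 * (L * η * τ) ^ 2 ≤ δ := by
    rw [Real.le_sqrt hη0.le (by positivity), le_div_iff₀ (by positivity)] at hη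
    linarith
  have run := isStochasticProjectedMomentum_run (β := β) (η := η) (τ := τ) (x₀ := x₀) hk hf hF hξ
    htop (Nat.one_le_iff_ne_zero.1 hB)
  rw [← hδ, ← hs] at run
  refine ⟨fun t _ => run.integrable_norm_gradient_sq hf.2 t, ?_⟩
  have sum_le := run.mul_sum_integral_norm_gradient_le hf.1 hbdd hf.2 (sq_nonneg s) hδ0 hδ1 hβ0
    hβ1 hτ0 period_long hη0 step_small K
  rw [← gap, ← hΔ] at sum_le
  rw [one_div, inv_mul_le_iff₀ (by positivity)]
  refine ((le_div_iff₀' hδ0).2 sum_le).trans_eq ?_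
  push_cast
  field_simp
  ring

theorem avgSqGradLE_iterate_mul_of_le_min {K : ℕ} (hβ0 : 0 < β) (hβ1 : β ≤ 1)
    (hτ : 64 / (3 * β * δ) ≤ (τ : ℝ)) (hη0 : 0 < η)
    (hη : η ≤ min (1 / (4 * L)) (min (√(3 * δ * β ^ 2 / (80 * L ^ 2)))
      (min (√(δ / (40 * (τ : ℝ) ^ 2 * L ^ 2))) (√(3 * β / (32 * (τ : ℝ) * L ^ 2))))))
    (hB : 1 ≤ B) (hK : 1 ≤ K) :
    AvgSqGradLE μ f (iterate F topk β η τ B x₀ ξ) (K * τ)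
      (16 * Δ / (δ * η * K * τ)
        + (160 / (3 * β * δ * τ * B) + 352 / (3 * δ ^ 2 * B) + 32 * β / (3 * δ)) * s ^ 2) := by
  simp only [le_min_iff] at hη
  have hδ0 : 0 < δ := hδ ▸ minDensity_pos hN hk
  have hδ1 : δ ≤ 1 := hδ ▸ minDensity_le_one hN fun ℓ => (hk ℓ).2
  have hΔ0 : 0 ≤ Δ := hΔ ▸ sub_nonneg.2 (ciInf_le hbdd x₀)
  have hτ0 : (0 : ℝ) < τ := lt_of_lt_of_le (by positivity) hτ
  refine (avgSqGradLE_iterate_mul hN hk hbdd hL hf hF hξ htop hδ hs hΔ hβ0 hβ1 hτ hη0 hη.2.2.1 hB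
    hK).mono ?_
  have gap_term : 9 * Δ / (δ * η * (K * τ)) ≤ 16 * Δ / (δ * η * K * τ) := by
    rw [← mul_assoc]
    gcongr
    norm_num
  have renewal_term : 9 / (δ * τ * B) ≤ 160 / (3 * β * δ * τ * B) := by
    rw [div_le_div_iff₀ (by positivity) (by positivity)]
    have : 0 < δ * τ * B := by positivity
    nlinarith
  have selection_term : 24 / (δ * B) ≤ 352 / (3 * δ ^ 2 * B) := by
    rw [div_le_div_iff₀ (by positivity) (by positivity)]
    have : 0 < δ * B := by positivity
    nlinarith
  have momentum_term : 9 * β / δ ≤ 32 * β / (3 * δ) := by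
    rw [div_le_div_iff₀ (by positivity) (by positivity)]
    nlinarith [mul_pos hβ0 hδ0]
  refine add_le_add gap_term (mul_le_mul_of_nonneg_right ?_ (sq_nonneg s))
  linarith

theorem avgSqGradLE_iterate_of_le {T : ℕ} (hβ0 : 0 < β) (hβ1 : β ≤ 1)
    (hτ : 64 / (3 * β * δ) ≤ (τ : ℝ)) (hη0 : 0 < η)
    (hη : η ≤ √(δ / (40 * (τ : ℝ) ^ 2 * L ^ 2))) (hB : 1 ≤ B) (hτT : τ ≤ T) :
    AvgSqGradLE μ f (iterate F topk β η τ B x₀ ξ) T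
      (9 * Δ / (δ * η * T) + 2 * ((24 / (δ * B) + 9 / (δ * τ * B) + 9 * β / δ) * s ^ 2)) := by
  have hδ0 : 0 < δ := hδ ▸ minDensity_pos hN hk
  have hτ0 : 0 < τ := Nat.cast_pos.1 (lt_of_lt_of_le (by positivity) hτ)
  have hT0 : 0 < T := hτ0.trans_le hτT
  obtain ⟨K, hTK, hKT⟩ := exists_mul_between_of_le hτ0 hτT
  have hK0 : 0 < K := Nat.pos_of_mul_pos_right (hT0.trans_le hTK)
  refine ((avgSqGradLE_iterate_mul hN hk hbdd hL hf hF hξ htop hδ hs hΔ hβ0 hβ1 hτ hη0 hη hB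
    hK0).of_longer hT0 hTK).mono ?_
  push_cast
  rw [mul_add]
  refine add_le_add (le_of_eq (by field_simp)) (mul_le_mul_of_nonneg_right ?_ (by positivity))
  exact (div_le_iff₀ (by positivity)).2 (mod_cast hKT)

variable (hΔ0 : 0 < Δ)

include hΔ0

theorem avgSqGradLE_iterate_choices {T : ℕ} (hT : minIterations L Δ s δ ≤ T)
    (hβ : β = betaChoice L Δ s δ T) (hτ : τ = tauChoice δ β) (hη : η = etaChoice L δ β τ)
    (hB : B = batchChoice δ β) :
    AvgSqGradLE μ f (iterate F topk β η τ B x₀ ξ) T (1800 * rateBound L Δ s δ T) := by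
  have hδ0 : 0 < δ := hδ ▸ minDensity_pos hN hk
  have hδ1 : δ ≤ 1 := hδ ▸ minDensity_le_one hN fun ℓ => (hk ℓ).2
  have hβ0 : 0 < β := hβ ▸ betaChoice_pos
  have hτ0 : 0 < τ := hτ ▸ tauChoice_pos hδ0 hβ0
  have hτT : τ ≤ T := by
    rw [hτ, hβ]
    exact tauChoice_betaChoice_le hL hΔ0 hδ0 hT
  refine (avgSqGradLE_iterate_of_le hN hk hbdd hL hf hF hξ htop hδ hs hΔ hβ0
    (hβ ▸ betaChoice_le_one) (hτ ▸ le_tauChoice) (hη ▸ etaChoice_pos hL)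
    (hη ▸ etaChoice_le_sqrt hL hδ0 hτ0) (hB ▸ one_le_batchChoice hδ0 hβ0) hτT).mono ?_
  rw [hη]
  exact choices_bound_le_rateBound hL hΔ0 hδ0 hδ1 (hτ0.trans_le hτT) hβ hτ hB

theorem exists_avgSqGradLE_iterate_and_gradientEvals_le {ε : ℝ} (hε : 0 < ε) :
    ∃ (T : ℕ) (β η : ℝ) (τ B : ℕ), minIterations L Δ s δ ≤ T ∧
      β = betaChoice L Δ s δ T ∧ τ = tauChoice δ β ∧ η = etaChoice L δ β τ ∧
      B = batchChoice δ β ∧ AvgSqGradLE μ f (iterate F topk β η τ B x₀ ξ) T ε ∧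
      (gradientEvals τ B T : ℝ) ≤
        38880000 * (L * Δ * s ^ 2 / (δ ^ (7 / 2 : ℝ) * ε ^ 2) + L * Δ / (δ ^ (5 / 2 : ℝ) * ε)
          + s ^ 2 / (δ ^ (1 / 2 : ℝ) * L * Δ) + 1 / δ) := by
  have hδ0 : 0 < δ := hδ ▸ minDensity_pos hN hk
  have hδ1 : δ ≤ 1 := hδ ▸ minDensity_le_one hN fun ℓ => (hk ℓ).2
  obtain ⟨T, hT, rate_le, T_le⟩ := exists_nat_mul_rateBound_le (c := 1800) (s := s) (by norm_num)
    hL hΔ0 hδ0 hε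
  refine ⟨T, _, _, _, _, hT, rfl, rfl, rfl, rfl, (avgSqGradLE_iterate_choices hN hk hbdd hL hf hF
    hξ htop hδ hs hΔ hΔ0 hT rfl rfl rfl rfl).mono rate_le, ?_⟩
  have hβ0 := betaChoice_pos (L := L) (Δ := Δ) (s := s) (δ := δ) (T := T)
  have evals_le : (gradientEvals (tauChoice δ (betaChoice L Δ s δ T))
      (batchChoice δ (betaChoice L Δ s δ T)) T : ℝ) ≤ 3 * T :=
    mod_cast gradientEvals_le (tauChoice_pos hδ0 hβ0) (tauChoice_betaChoice_le hL hΔ0 hδ0 hT)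
      (batchChoice_le_tauChoice hδ0 hβ0)
  have min_le := minIterations_le (s := s) hL hΔ0 hδ0 hδ1
  have one_le := (one_le_div hδ0).2 hδ1
  have : 0 ≤ L * Δ * s ^ 2 / (δ ^ (7 / 2 : ℝ) * ε ^ 2) := by positivity
  have : 0 ≤ L * Δ / (δ ^ (5 / 2 : ℝ) * ε) := by positivity
  have : 0 ≤ s ^ 2 / (δ ^ (1 / 2 : ℝ) * L * Δ) := by positivity
  linarith

end Convergence

end GaSare

theorem mainTheorem7 :
    ∃ C : ℝ, 0 < C ∧
      ∀ (N : ℕ) (m n k : Fin N → ℕ), 0 < N → (∀ ℓ, 1 ≤ k ℓ ∧ k ℓ ≤ m ℓ * n ℓ) →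
      ∀ (Ω : Type v) [MeasurableSpace Ω] (μ : Measure Ω) [IsProbabilityMeasure μ]
        (Ξ : Type u) [MeasurableSpace Ξ] (𝒟 : Measure Ξ) [IsProbabilityMeasure 𝒟]
        (f : GaSare.Params m n → ℝ) (F : GaSare.Params m n → Ξ → ℝ)
        (L : ℝ) (σ : Fin N → ℝ) (ξ : ℕ → ℕ → Ω → Ξ) (x₀ : GaSare.Params m n)
        (topk : (ℓ : Fin N) →
          Matrix (Fin (m ℓ)) (Fin (n ℓ)) ℝ → Matrix (Fin (m ℓ)) (Fin (n ℓ)) ℝ),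
      BddBelow (Set.range f) → 0 < L → GaSare.IsSmooth L f →
      (∀ ℓ, 0 < σ ℓ) → GaSare.IsGradientOracle f F 𝒟 σ →
      GaSare.IsSampleStream μ 𝒟 ξ → (∀ ℓ, GaSare.IsTopKRule (k ℓ) (topk ℓ)) →
      ∀ (δ s Δ : ℝ), δ = GaSare.minDensity m n k → s = GaSare.totalSigma σ →
        Δ = GaSare.gap f x₀ →
      -- bound for general hyperparameters
      (∀ (β η : ℝ) (τ B K : ℕ), 0 < β → β ≤ 1 → 64 / (3 * β * δ) ≤ (τ : ℝ) → 0 < η →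
        η ≤ min (1 / (4 * L)) (min (√(3 * δ * β ^ 2 / (80 * L ^ 2)))
          (min (√(δ / (40 * (τ : ℝ) ^ 2 * L ^ 2))) (√(3 * β / (32 * (τ : ℝ) * L ^ 2))))) →
        1 ≤ B → 1 ≤ K →
        GaSare.AvgSqGradLE μ f (GaSare.iterate F topk β η τ B x₀ ξ) (K * τ)
          (16 * Δ / (δ * η * K * τ)
            + (160 / (3 * β * δ * τ * B) + 352 / (3 * δ ^ 2 * B) + 32 * β / (3 * δ)) * s ^ 2)) ∧
      -- rate for the specific hyperparameters
      (0 < Δ → ∀ (T : ℕ) (β η : ℝ) (τ B : ℕ), GaSare.minIterations L Δ s δ ≤ (T : ℝ) →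
        β = GaSare.betaChoice L Δ s δ T → τ = GaSare.tauChoice δ β →
        η = GaSare.etaChoice L δ β τ → B = GaSare.batchChoice δ β →
        GaSare.AvgSqGradLE μ f (GaSare.iterate F topk β η τ B x₀ ξ) T
          (C * (L * Δ / (δ ^ (5 / 2 : ℝ) * T)
            + √(L * Δ * s ^ 2 / (δ ^ (7 / 2 : ℝ) * T))))) ∧
      -- complexity of reaching accuracy `ε`
      (0 < Δ → ∀ ε : ℝ, 0 < ε → ∃ (T : ℕ) (β η : ℝ) (τ B : ℕ),
        GaSare.minIterations L Δ s δ ≤ (T : ℝ) ∧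
        β = GaSare.betaChoice L Δ s δ T ∧ τ = GaSare.tauChoice δ β ∧
        η = GaSare.etaChoice L δ β τ ∧ B = GaSare.batchChoice δ β ∧
        GaSare.AvgSqGradLE μ f (GaSare.iterate F topk β η τ B x₀ ξ) T ε ∧
        (GaSare.gradientEvals τ B T : ℝ) ≤
          C * (L * Δ * s ^ 2 / (δ ^ (7 / 2 : ℝ) * ε ^ 2) + L * Δ / (δ ^ (5 / 2 : ℝ) * ε)
            + s ^ 2 / (δ ^ (1 / 2 : ℝ) * L * Δ) + 1 / δ)) := by
  refine ⟨38880000, by norm_num, ?_⟩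
  intro N m n k hN hk Ω _ μ _ Ξ _ 𝒟 _ f F L σ ξ x₀ topk hbdd hL hf _ hF hξ htop δ s Δ hδ hs hΔ
  have hδ0 : 0 < δ := hδ ▸ GaSare.minDensity_pos hN hk
  refine ⟨fun β η τ B K hβ0 hβ1 hτ hη0 hη hB hK => ?_,
    fun hΔ0 T β η τ B hT hβ hτ hη hB => ?_, fun hΔ0 ε hε => ?_⟩
  · exact GaSare.avgSqGradLE_iterate_mul_of_le_min hN hk hbdd hL hf hF hξ htop hδ hs hΔ hβ0 hβ1 hτ
      hη0 hη hB hK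
  · refine (GaSare.avgSqGradLE_iterate_choices hN hk hbdd hL hf hF hξ htop hδ hs hΔ hΔ0 hT hβ hτ hη
      hB).mono ?_
    exact mul_le_mul_of_nonneg_right (by norm_num) (GaSare.rateBound_nonneg hL hΔ0 hδ0)
  · exact GaSare.exists_avgSqGradLE_iterate_and_gradientEvals_le hN hk hbdd hL hf hF hξ htop hδ hs
      hΔ hΔ0 hε
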